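/- Let $V$ be an $n$-dimensional real affine space. A polytope $P \subset V$ is a compact set with non-empty interior that is a finite intersection of half spaces; it is simple if every vertex lies on precisely $n$ facets. A flat measure on $P$ (resp. on a facet of $P$) is the restriction of a translation invariant measure on $V$ (resp. on the affine span of the facet) which gives positive finite mass to non-empty relatively compact open sets; a flat measure on $\partial P$ is a measure on $\partial P$ whose restriction to each facet is flat. Let $\mathcal P = (P, d\mu, d\sigma)$ be a system: a simple polytope $P$ with a flat measure $d\mu$ on $P$ and a flat measure $d\sigma$ on $\partial P$. A state is a lower semicontinuous log convex function $u : P \to (0, \infty]$ with $\int_P u\, d\mu = \int_P d\mu$; here log convex means $u((1-t)x_0 + t x_1) \le u(x_0)^{1-t} u(x_1)^t$ for $x_0, x_1 \in P$, $t \in [0,1]$. For a state $u$ put $$S_{\mathcal P}(u) = -\frac{1}{\int_P d\mu}\int_P u \log u \, d\mu \in [-\infty, 0], \qquad U_{\mathcal P}(u) = \frac{1}{\int_P d\mu}\int_{\partial P} u \, d\sigma \in [0,\infty]$$ (entropy and internal $\mu$-energy) and, for $T \in \mathbb R$, $F_{\mathcal P}(T,u) = U_{\mathcal P}(u) - T S_{\mathcal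 P}(u)$ if $S_{\mathcal P}(u) > -\infty$ and $F_{\mathcal P}(T,u) = \infty$ otherwise. Let $1_P$ be the constant state $1$. For $T > 0$ the $\mu$-canonical distribution of temperature $T$ is the unique minimizer of $F_{\mathcal P}(T, \cdot)$ among states; for $T = 0$ it is the unique minimizer of $F_{\mathcal P}(0, \cdot)$ that maximizes $S_{\mathcal P}$ among all minimizers of $F_{\mathcal P}(0,\cdot)$; for $T = \infty$ it is, by convention, $1_P$. An equilibrium of internal $\mu$-energy $U$ is a state $u$ with $U_{\mathcal P}(u) = U$ and $S_{\mathcal P}(v) \le S_{\mathcal P}(u)$ for every state $v$ with $U_{\mathcal P}(v) = U$. Theorem (Existence of equilibrium). The minimum $\min U_{\mathcal P}$ of $U_{\mathcal P}$ over all states is attained. For every $U \in [\min U_{\mathcal P}, U_{\mathcal P}(1_P)]$ there is a unique equilibrium of internal $\mu$-energy $U$. This equilibrium is the $\mu$-canonical distribution of some temperature $T \in [0, \infty]$. More precisely, $T$ can be taken finite unless $U = U_{\mathcal P}(1_P) > \min U_{\mathcal P}$ and the equilibrium is $1_P$ (temperature $\infty$). -/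

import Mathlib

open MeasureTheory Module
open scoped ENNReal

noncomputable section

namespace MuEntropy

section Polytopes

variable {E : Type*} [NormedAddCommGroup E] [NormedSpace ℝ E]

/-- A half space: `{ℓ ≥ 0}` for a non-zero affine function `ℓ`. -/
def IsHalfSpace (H : Set E) : Prop :=
  ∃ ℓ : E →ᵃ[ℝ] ℝ, ℓ ≠ 0 ∧ H = {x | 0 ≤ ℓ x}

/-- A (full-dimensional) polytope: compact, with non-empty interior, and a finite intersection
of half spaces. -/
def IsPolytope (P : Set E) : Prop :=
  IsCompact P ∧ (interior P).Nonempty ∧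
    ∃ 𝓗 : Set (Set E), 𝓗.Finite ∧ (∀ H ∈ 𝓗, IsHalfSpace H) ∧ P = ⋂₀ 𝓗

/-- A face of `P`: the intersection of `P` with the bounding hyperplane `{ℓ = 0}` of a half space
`{ℓ ≥ 0}` which contains `P`. -/
def IsFace (P F : Set E) : Prop :=
  ∃ ℓ : E →ᵃ[ℝ] ℝ, ℓ ≠ 0 ∧ (∀ x ∈ P, 0 ≤ ℓ x) ∧ F = {x ∈ P | ℓ x = 0}

/-- A facet: a non-empty face whose affine span has codimension one. -/
def IsFacet (P F : Set E) : Prop :=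
  IsFace P F ∧ F.Nonempty ∧ finrank ℝ (affineSpan ℝ F).direction + 1 = finrank ℝ E

/-- A simple polytope: every vertex (one-point face) lies on precisely `n = dim E` facets. -/
def IsSimplePolytope (P : Set E) : Prop :=
  IsPolytope P ∧
    ∀ x : E, IsFace P {x} → {F : Set E | IsFacet P F ∧ x ∈ F}.ncard = finrank ℝ E

variable [MeasurableSpace E]

/-- `ν` is a flat measure on `F`: the restriction to `F` of a translation invariant measure on the
affine span `W` of `F`, that is, of the image of a Haar measure on the direction of `W` under
`v ↦ v + p` for a point `p` of `W`. -/
def IsFlatMeasureOn (F : Set E) (ν : Measure E) : Prop :=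
  ∃ (τ : Measure (affineSpan ℝ F).direction) (p : E), τ.IsAddHaarMeasure ∧
    p ∈ affineSpan ℝ F ∧
    ν = (τ.map (fun v : (affineSpan ℝ F).direction => (v : E) + p)).restrict F

end Polytopes

/-- A (simple non-archimedean Hamiltonian) system `(P, dμ, dσ)`: a simple polytope `P`, a flat
measure `μ` on `P`, and a flat measure `σ` on the boundary `∂P`, i.e. a measure carried by `∂P`
whose restriction to each facet is flat. -/
structure System (E : Type*) [NormedAddCommGroup E] [NormedSpace ℝ E] [MeasurableSpace E] where
  P : Set E
  μ : Measure E
  σ : Measure E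
  simple : IsSimplePolytope P
  flat_μ : ∃ ν : Measure E, ν.IsAddHaarMeasure ∧ μ = ν.restrict P
  σ_compl : σ (frontier P)ᶜ = 0
  flat_σ : ∀ F : Set E, IsFacet P F → IsFlatMeasureOn F (σ.restrict F)

/-- The integral of an extended real valued function, `∫ f⁺ - ∫ f⁻`; it is only used for functions
whose negative part has finite integral. -/
def eintegral {α : Type*} [MeasurableSpace α] (m : Measure α) (f : α → EReal) : EReal :=
  ((∫⁻ x, (f x).toENNReal ∂m : ℝ≥0∞) : EReal) - ((∫⁻ x, (-f x).toENNReal ∂m : ℝ≥0∞) : EReal)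

namespace System

variable {E : Type*} [NormedAddCommGroup E] [NormedSpace ℝ E] [MeasurableSpace E]
  (𝒮 : System E)

/-- The measure `dμ`, on the space `P`. -/
def bulk : Measure 𝒮.P := 𝒮.μ.comap (↑)

/-- The measure `dσ`, on the space `P` (it is carried by `∂P`). -/
def bdry : Measure 𝒮.P := 𝒮.σ.comap (↑)

/-- States: lower semicontinuous log convex functions `u : P → (0, ∞]` with `∫ u dμ = ∫ dμ`. As
`∫ dμ` is finite, integrability is part of the normalization. -/
structure IsState (u : 𝒮.P → ℝ≥0∞) : Prop where
  pos : ∀ x, 0 < u x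
  lsc : LowerSemicontinuous u
  logConvex : ∀ (x y z : 𝒮.P) (t : ℝ), 0 ≤ t → t ≤ 1 →
    (z : E) = (1 - t) • (x : E) + t • (y : E) → u z ≤ u x ^ (1 - t) * u y ^ t
  normalized : ∫⁻ x, u x ∂𝒮.bulk = 𝒮.μ 𝒮.P

/-- The trivial state `1_P`. -/
def one : 𝒮.P → ℝ≥0∞ := fun _ => 1

/-- The entropy `S(u) = - (∫_P dμ)⁻¹ ∫_P u log u dμ`, with values in `[-∞, 0]` on states. -/
def entropy (u : 𝒮.P → ℝ≥0∞) : EReal :=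
  -(eintegral 𝒮.bulk (fun x => (u x : EReal) * ENNReal.log (u x)) / (𝒮.μ 𝒮.P : EReal))

/-- The internal μ-energy `U(u) = (∫_P dμ)⁻¹ ∫_{∂P} u dσ`. -/
def energy (u : 𝒮.P → ℝ≥0∞) : ℝ≥0∞ :=
  (∫⁻ x, u x ∂𝒮.bdry) / 𝒮.μ 𝒮.P

open Classical in
/-- The free μ-energy `F(T, u)`, equal to `U(u) - T S(u)` if `S(u) > -∞` and to `∞` otherwise. -/
def freeEnergy (T : ℝ) (u : 𝒮.P → ℝ≥0∞) : EReal :=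
  if 𝒮.entropy u = ⊥ then ⊤ else (𝒮.energy u : EReal) - (T : EReal) * 𝒮.entropy u

/-- `u` minimizes `F(T, ·)` among all states. -/
def IsMinimizer (T : ℝ) (u : 𝒮.P → ℝ≥0∞) : Prop :=
  𝒮.IsState u ∧ ∀ v, 𝒮.IsState v → 𝒮.freeEnergy T u ≤ 𝒮.freeEnergy T v

/-- `u` is a minimizer of `F(0, ·)` with the largest entropy among all minimizers of `F(0, ·)`. -/
def IsMaxEntropyGroundState (u : 𝒮.P → ℝ≥0∞) : Prop :=
  𝒮.IsMinimizer 0 u ∧ ∀ v, 𝒮.IsMinimizer 0 v → 𝒮.entropy v ≤ 𝒮.entropy u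

/-- `u` is the μ-canonical distribution of temperature `T ∈ [0, ∞)`: for `T > 0` it is the unique
minimizer of `F(T, ·)`, and for `T = 0` it is the unique minimizer of `F(0, ·)` with the largest
entropy among all minimizers of `F(0, ·)`. -/
def IsCanonical (T : ℝ) (u : 𝒮.P → ℝ≥0∞) : Prop :=
  (0 < T ∧ 𝒮.IsMinimizer T u ∧ ∀ v, 𝒮.IsMinimizer T v → v = u) ∨
  (T = 0 ∧ 𝒮.IsMaxEntropyGroundState u ∧ ∀ v, 𝒮.IsMaxEntropyGroundState v → v = u)

/-- `u` is an equilibrium of internal μ-energy `U`: it maximizes the entropy among the states of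
internal μ-energy `U`. -/
def IsEquilibrium (U : ℝ≥0∞) (u : 𝒮.P → ℝ≥0∞) : Prop :=
  𝒮.IsState u ∧ 𝒮.energy u = U ∧
    ∀ v, 𝒮.IsState v → 𝒮.energy v = U → 𝒮.entropy v ≤ 𝒮.entropy u

end System

end MuEntropy

end

open Set Filter Topology

set_option linter.unusedSectionVars false

/-! ### Polytopes: boundary points and facets. -/

namespace MuEntropy

section Geometry

variable {E : Type*} [NormedAddCommGroup E] [NormedSpace ℝ E]

/-! Maximizing entropy means minimizing the convex functional `R(u) = ∫ u log u dμ` (`relEntropy`)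
over the states of energy at most `c` (`IsOptimal`).

Finite energy controls `R`. States are bounded at a fixed interior point `p`, uniformly in the
state, by the mean value inequality for convex functions. On a ray from `p` to a boundary point `x`,
log convexity bounds `u` by `A V ^ s` with `V = 1 + u x`, and `∫ V ^ s log V ds = V - 1` over `[0,
1]`, so `u log u` integrates along the ray to at most a constant times `V`. Integrating over the
facets bounds `R` linearly in the energy (`exists_lintegral_mulLogPos_le`).

Existence uses strong convexity instead of weak compactness. The midpoint inequality for `R` gains a
quarter of `∫ (√u - √v)²` (`relEntropy_midpoint_le`), so the square roots of a minimizing sequence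
are Cauchy in `L²`; no mass is lost, and a subsequence converges almost everywhere. Convexity
upgrades this to convergence in the interior, and the limit extends to the boundary as a state lying
below the lower limit of the sequence (`exists_isState_of_tendsto_ae`). Fatou's lemma then gives
semicontinuity of the energy and of `R` (`exists_limit_state`), hence `exists_isOptimal`. The same
inequality gives every uniqueness statement.

For `U` at most the energy of `1_P` the constraint is sharp, since mixing with `1_P`, where `R` is
least, would improve a slack optimum; so optimal states and equilibria coincide. At the least energy
the optimum has temperature zero; at the energy of `1_P` it is `1_P`; strictly between, a Lagrange
multiplier `β > 0` exists by convexity, and the temperature is `mass / β`. -/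

theorem IsPolytope.exists_affine {P : Set E} (hP : IsPolytope P) :
    ∃ L : Set (E →ᵃ[ℝ] ℝ), L.Finite ∧ (∀ ℓ ∈ L, ℓ ≠ 0) ∧ P = {x | ∀ ℓ ∈ L, 0 ≤ ℓ x} := by
  obtain ⟨-, -, 𝓗, hfin, hhalf, rfl⟩ := hP
  choose! f hf0 hf using hhalf
  refine ⟨f '' 𝓗, hfin.image f, ?_, ?_⟩
  · rintro _ ⟨H, hH, rfl⟩
    exact hf0 H hH
  · ext x
    simp only [mem_sInter, mem_ofPred_eq, forall_mem_image]
    refine forall₂_congr fun H hH => ?_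
    conv_lhs => rw [hf H hH]
    rfl

theorem convex_setOf_affine_nonneg (L : Set (E →ᵃ[ℝ] ℝ)) : Convex ℝ {x | ∀ ℓ ∈ L, 0 ≤ ℓ x} := by
  have : {x | ∀ ℓ ∈ L, 0 ≤ ℓ x} = ⋂ ℓ ∈ L, ℓ ⁻¹' Ici 0 := by ext; simp
  rw [this]
  exact convex_iInter₂ fun ℓ _ => (convex_Ici 0).affine_preimage ℓ

theorem IsPolytope.convex {P : Set E} (hP : IsPolytope P) : Convex ℝ P := by
  obtain ⟨L, -, -, rfl⟩ := hP.exists_affine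
  exact convex_setOf_affine_nonneg L

/-- If `ℓ` vanished at `p`, then `t * ℓ.linear v` would be non-negative for small `t` of both signs;
the linear part would be zero, and with it `ℓ`. -/
theorem affine_pos_of_mem_interior {P : Set E} {ℓ : E →ᵃ[ℝ] ℝ} (hℓ : ℓ ≠ 0)
    (hP : ∀ x ∈ P, 0 ≤ ℓ x) {p : E} (hp : p ∈ interior P) : 0 < ℓ p := by
  refine (hP p (interior_subset hp)).lt_of_ne fun h0 => hℓ ?_
  have hlin : ∀ v : E, ℓ.linear v = 0 := by
    intro v
    have hc : Tendsto (fun t : ℝ => p + t • v) (𝓝 0) (𝓝 p) := by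
      have : Continuous fun t : ℝ => p + t • v := by fun_prop
      simpa using this.tendsto 0
    obtain ⟨ε, hε, h⟩ := Metric.eventually_nhds_iff.1
      (hc.eventually (mem_interior_iff_mem_nhds.1 hp))
    have key : ∀ t : ℝ, |t| < ε → 0 ≤ t * ℓ.linear v := by
      intro t ht
      have h1 := hP _ (h (y := t) (by simpa using ht))
      have h2 : ℓ (p + t • v) = ℓ p + t * ℓ.linear v := by
        have := ℓ.map_vadd p (t • v)
        simp only [vadd_eq_add, map_smul, smul_eq_mul] at this
        rw [add_comm p, this, add_comm]
      rw [h2, ← h0, zero_add] at h1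
      exact h1
    have h1 := key (ε / 2) (by rw [abs_of_pos (by positivity)]; linarith)
    have h2 := key (-(ε / 2)) (by rw [abs_neg, abs_of_pos (by positivity)]; linarith)
    nlinarith
  ext x
  have := ℓ.map_vadd p (x - p)
  simp only [vadd_eq_add, sub_add_cancel, hlin, ← h0, add_zero] at this
  simpa using this

/-- A segment avoiding the frontier would be disconnected by the interior and the complement of the
closure. -/
theorem exists_mem_segment_frontier {P : Set E} {y z : E} (hy : y ∈ P) (hz : z ∉ P) :
    ∃ w ∈ segment ℝ y z, w ∈ frontier P := by
  have hpre : IsPreconnected (segment ℝ y z) := (convex_segment y z).isPreconnected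
  by_contra! h
  have h1 : segment ℝ y z ⊆ interior P ∪ (closure P)ᶜ := by
    intro w hw
    by_contra hcon
    simp only [mem_union, mem_compl_iff, not_or, not_not] at hcon
    exact h w hw ⟨hcon.2, hcon.1⟩
  have h2 := hpre _ _ isOpen_interior isClosed_closure.isOpen_compl h1
    ⟨y, left_mem_segment ℝ y z, by
      rcases h1 (left_mem_segment ℝ y z) with h | h
      · exact h
      · exact absurd (subset_closure hy) h⟩
    ⟨z, right_mem_segment ℝ y z, by
      rcases h1 (right_mem_segment ℝ y z) with h | h
      · exact absurd (interior_subset h) hz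
      · exact h⟩
  obtain ⟨w, -, hw1, hw2⟩ := h2
  exact hw2 (subset_closure (interior_subset hw1))

variable [FiniteDimensional ℝ E]

theorem exists_affine_eq_zero_of_mem_frontier {L : Set (E →ᵃ[ℝ] ℝ)} (hL : L.Finite) {x : E}
    (hx : x ∈ frontier {x | ∀ ℓ ∈ L, 0 ≤ ℓ x}) :
    (∀ ℓ ∈ L, 0 ≤ ℓ x) ∧ ∃ ℓ ∈ L, ℓ x = 0 := by
  have hcl : IsClosed {x | ∀ ℓ ∈ L, 0 ≤ ℓ x} := by
    have : {x | ∀ ℓ ∈ L, 0 ≤ ℓ x} = ⋂ ℓ ∈ L, ℓ ⁻¹' Ici 0 := by ext; simp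
    rw [this]
    exact isClosed_biInter fun ℓ _ => isClosed_Ici.preimage ℓ.continuous_of_finiteDimensional
  have hxP : ∀ ℓ ∈ L, 0 ≤ ℓ x := hcl.frontier_subset hx
  refine ⟨hxP, ?_⟩
  by_contra! h
  have hopen : IsOpen (⋂ ℓ ∈ L, ℓ ⁻¹' Ioi 0) :=
    hL.isOpen_biInter fun ℓ _ => isOpen_Ioi.preimage ℓ.continuous_of_finiteDimensional
  refine hx.2 (mem_interior.2 ⟨_, ?_, hopen, ?_⟩)
  · intro y hy ℓ hℓ
    exact (mem_iInter₂.1 hy ℓ hℓ).le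
  · exact mem_iInter₂.2 fun ℓ hℓ => (hxP ℓ hℓ).lt_of_ne (h ℓ hℓ).symm

/-- Every boundary point of a polytope lies on a facet cut out by one of the given half spaces. -/
theorem exists_isFacet_of_mem_frontier {L : Set (E →ᵃ[ℝ] ℝ)} (hL : L.Finite)
    (hL0 : ∀ ℓ ∈ L, ℓ ≠ 0) {P : Set E} (hP : P = {x | ∀ ℓ ∈ L, 0 ≤ ℓ x})
    (hint : (interior P).Nonempty) {x : E} (hx : x ∈ frontier P) :
    ∃ ℓ ∈ L, ℓ x = 0 ∧ IsFacet P {y ∈ P | ℓ y = 0} := by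
  have hPconv : Convex ℝ P := hP ▸ convex_setOf_affine_nonneg L
  have hLP : ∀ ℓ ∈ L, ∀ y ∈ P, 0 ≤ ℓ y := by
    intro ℓ hℓ y hy
    rw [hP] at hy
    exact hy ℓ hℓ
  obtain ⟨p, hp⟩ := hint
  obtain ⟨hxP, ℓ₀, hℓ₀, hxℓ₀⟩ := exists_affine_eq_zero_of_mem_frontier hL (hP ▸ hx)
  have hxP' : x ∈ P := by rw [hP]; exact hxP
  have hcont : ∀ ℓ : E →ᵃ[ℝ] ℝ, Continuous ℓ := fun ℓ => ℓ.continuous_of_finiteDimensional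
  -- a ball around `x` on which the inactive functions stay positive
  have hnhds : ∀ᶠ y in 𝓝 x, ∀ ℓ ∈ L, ℓ x ≠ 0 → 0 < ℓ y := by
    refine (hL.eventually_all).2 fun ℓ hℓ => ?_
    by_cases h : ℓ x = 0
    · simp [h]
    · have := (hcont ℓ).continuousAt.eventually (lt_mem_nhds ((hxP ℓ hℓ).lt_of_ne (Ne.symm h)))
      filter_upwards [this] with y hy _ using hy
  obtain ⟨ε, hε, hball⟩ := Metric.eventually_nhds_iff_ball.1 hnhds
  have hs : ∃ s : ℝ, 0 < s ∧ s ≤ 1 ∧ x + s • (p - x) ∈ Metric.ball x ε ∧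
      x - s • (p - x) ∈ Metric.ball x ε := by
    have h1 : Tendsto (fun s : ℝ => x + s • (p - x)) (𝓝 0) (𝓝 x) := by
      have : Continuous fun s : ℝ => x + s • (p - x) := by fun_prop
      simpa using this.tendsto 0
    have h2 : Tendsto (fun s : ℝ => x - s • (p - x)) (𝓝 0) (𝓝 x) := by
      have : Continuous fun s : ℝ => x - s • (p - x) := by fun_prop
      simpa using this.tendsto 0
    have h3 := ((h1.eventually (Metric.ball_mem_nhds x hε)).and
      (h2.eventually (Metric.ball_mem_nhds x hε))).filter_mono (nhdsWithin_le_nhds (s := Ioi 0))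
    obtain ⟨s, ⟨hs1, hs2⟩, hs3, hs4⟩ := (h3.and (Ioc_mem_nhdsGT (zero_lt_one' ℝ))).exists
    exact ⟨s, hs3, hs4, hs1, hs2⟩
  obtain ⟨s, hs0, hs1, hy₀, hz⟩ := hs
  -- `z` lies just behind `x`, outside `P`, and `y₀` just inside. Segments from interior points near
  -- `x` to `z` cross the frontier near `x`, where only functions active at `x` can vanish.
  set z := x - s • (p - x) with hzdef
  set y₀ := x + s • (p - x) with hy₀def
  have hzP : z ∉ P := by
    intro hzP
    have h1 := hLP ℓ₀ hℓ₀ z hzP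
    have h2 := affine_pos_of_mem_interior (hL0 ℓ₀ hℓ₀) (hLP ℓ₀ hℓ₀) hp
    have h3 : ℓ₀ z = ℓ₀ x - s * (ℓ₀ p - ℓ₀ x) := by
      have e : z = AffineMap.lineMap x p (-s) := by
        rw [AffineMap.lineMap_apply, hzdef, vsub_eq_sub, vadd_eq_add]; module
      rw [e, AffineMap.apply_lineMap, AffineMap.lineMap_apply]
      simp; ring
    rw [h3, hxℓ₀] at h1
    nlinarith
  have hy₀int : y₀ ∈ interior P := by
    rcases hs1.eq_or_lt with rfl | hs1
    · simpa [hy₀def] using hp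
    · exact hPconv.openSegment_self_interior_subset_interior hxP' hp
        ⟨1 - s, s, by linarith, hs0, by ring, by rw [hy₀def]; module⟩
  by_contra! hno
  -- the union of the spans of `z` and the active faces would cover an open set
  let A : (E →ᵃ[ℝ] ℝ) → AffineSubspace ℝ E := fun ℓ => affineSpan ℝ (insert z {y ∈ P | ℓ y = 0})
  have hcover : interior P ∩ Metric.ball x ε ⊆
      ⋃ ℓ ∈ {ℓ ∈ L | ℓ x = 0 ∧ {y ∈ P | ℓ y = 0}.Nonempty}, (A ℓ : Set E) := by
    rintro y ⟨hyP, hyb⟩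
    obtain ⟨w, hw, hwf⟩ := exists_mem_segment_frontier (interior_subset hyP) hzP
    obtain ⟨hwP, ℓ, hℓ, hwℓ⟩ := exists_affine_eq_zero_of_mem_frontier hL (hP ▸ hwf)
    have hwP' : w ∈ P := by rw [hP]; exact hwP
    have hwb : w ∈ Metric.ball x ε := (convex_ball x ε).segment_subset hyb hz hw
    have hxℓ : ℓ x = 0 := by
      by_contra h
      exact (hball w hwb ℓ hℓ h).ne' hwℓ
    refine mem_iUnion₂.2 ⟨ℓ, ⟨hℓ, hxℓ, w, hwP', hwℓ⟩, ?_⟩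
    obtain ⟨a, b, ha, hb, hab, rfl⟩ := hw
    have ha0 : a ≠ 0 := by
      rintro rfl
      apply hzP
      have : b = 1 := by linarith
      simpa [this] using hwP'
    have e : y = AffineMap.lineMap z (a • y + b • z) (1 / a) := by
      rw [AffineMap.lineMap_apply, vsub_eq_sub, vadd_eq_add]
      have : b = 1 - a := by linarith
      subst this
      have : (1 / a) • (a • y + (1 - a) • z - z) = y - z := by
        have : a • y + (1 - a) • z - z = a • (y - z) := by module
        rw [this, smul_smul, one_div_mul_cancel ha0, one_smul]
      rw [this]; abel
    rw [e]
    exact AffineMap.lineMap_mem _ (mem_affineSpan ℝ (mem_insert _ _))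
      (mem_affineSpan ℝ (mem_insert_of_mem _ ⟨hwP', hwℓ⟩))
  let : MeasurableSpace E := borel E
  have : BorelSpace E := ⟨rfl⟩
  have hnull : (Measure.addHaar : Measure E)
      (⋃ ℓ ∈ {ℓ ∈ L | ℓ x = 0 ∧ {y ∈ P | ℓ y = 0}.Nonempty}, (A ℓ : Set E)) = 0 := by
    refine (measure_biUnion_null_iff (hL.subset fun ℓ h => h.1).countable).2 fun ℓ hℓ => ?_
    obtain ⟨hℓL, hℓx, hne⟩ := hℓ
    -- If the face and `z` span `E`, the face spans dimension at least `n - 1`. It lies in a level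
    -- set of `ℓ`, whose linear part is non-zero as `ℓ x = 0 < ℓ p`, so the dimension is exactly `n
    -- - 1` and the face is a facet.
    refine Measure.addHaar_affineSubspace _ _ fun htop => ?_
    have h1 : finrank ℝ (A ℓ).direction = finrank ℝ E := by
      rw [htop, AffineSubspace.direction_top, finrank_top]
    have h2 := finrank_vectorSpan_insert_le_set ℝ {y ∈ P | ℓ y = 0} z
    rw [← direction_affineSpan, ← direction_affineSpan] at h2
    change finrank ℝ (A ℓ).direction ≤ _ at h2
    have hker : (affineSpan ℝ {y ∈ P | ℓ y = 0}).direction ≤ LinearMap.ker ℓ.linear := by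
      rw [direction_affineSpan, vectorSpan_def, Submodule.span_le]
      rintro _ ⟨a, ha, b, hb, rfl⟩
      rw [SetLike.mem_coe, LinearMap.mem_ker, AffineMap.linearMap_vsub, ha.2, hb.2, vsub_self]
    have hlin : ℓ.linear ≠ 0 := by
      intro h0
      have hpp := affine_pos_of_mem_interior (hL0 ℓ hℓL) (hLP ℓ hℓL) hp
      have := ℓ.linearMap_vsub p x
      rw [h0, hℓx] at this
      simp at this
      linarith
    have h3 := Submodule.finrank_mono hker
    have h4 : finrank ℝ (LinearMap.ker ℓ.linear) < finrank ℝ E :=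
      Submodule.finrank_lt (by rwa [ne_eq, LinearMap.ker_eq_top])
    refine hno ℓ hℓL hℓx ⟨⟨ℓ, hL0 ℓ hℓL, hLP ℓ hℓL, rfl⟩, hne, ?_⟩
    omega
  have hpos : 0 < (Measure.addHaar : Measure E) (interior P ∩ Metric.ball x ε) :=
    (isOpen_interior.inter Metric.isOpen_ball).measure_pos _ ⟨y₀, hy₀int, hy₀⟩
  exact hpos.ne' (measure_mono_null hcover hnull)

end Geometry
end MuEntropy

/-! ### Integration over the cones from an interior point to the facets. -/

namespace MuEntropy

section Cone

variable {E : Type*} [NormedAddCommGroup E] [NormedSpace ℝ E] [FiniteDimensional ℝ E]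
  [MeasurableSpace E] [BorelSpace E]

/-- The cone over the part of `F` in `{ℓ = 0}`, with apex `p` (which is removed). -/
def facetCone (ℓ : E →ᵃ[ℝ] ℝ) (p : E) (F : Set E) : Set E :=
  {y | 0 < 1 - ℓ y / ℓ p ∧ 1 - ℓ y / ℓ p ≤ 1 ∧ p + (1 - ℓ y / ℓ p)⁻¹ • (y - p) ∈ F}

theorem measurableSet_facetCone (ℓ : E →ᵃ[ℝ] ℝ) (p : E) {F : Set E} (hF : MeasurableSet F) :
    MeasurableSet (facetCone ℓ p F) := by
  have hℓ : Measurable ℓ := ℓ.continuous_of_finiteDimensional.measurable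
  have h1 : Measurable fun y => 1 - ℓ y / ℓ p := measurable_const.sub (hℓ.div_const _)
  refine (measurableSet_lt measurable_const h1).inter
    ((measurableSet_le h1 measurable_const).inter ?_)
  exact (measurable_const.add (h1.inv.smul (measurable_id.sub_const p))) hF

/-- The substitution has Jacobian `s ^ dim W ≤ 1`. Dropping it discards the polar weight, which
upper bounds do not need. -/
theorem lintegral_le_lintegral_comp_smul {W : Type*} [NormedAddCommGroup W] [NormedSpace ℝ W]
    [FiniteDimensional ℝ W] [MeasurableSpace W] [BorelSpace W] (τ : Measure W)
    [τ.IsAddHaarMeasure] {s : ℝ} (hs0 : 0 < s) (hs1 : s ≤ 1) {h : W → ℝ≥0∞} (hh : Measurable h) :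
    ∫⁻ v, h v ∂τ ≤ ∫⁻ v, h (s • v) ∂τ := by
  have h1 : ∫⁻ v, h (s • v) ∂τ = ∫⁻ v, h v ∂(τ.map (s • ·)) :=
    (lintegral_map hh (measurable_const_smul s)).symm
  rw [h1, Measure.map_addHaar_smul τ hs0.ne', lintegral_smul_measure, smul_eq_mul]
  refine le_mul_of_one_le_left' ?_
  rw [ENNReal.one_le_ofReal, abs_of_nonneg (by positivity)]
  exact (one_le_inv₀ (by positivity)).2 (pow_le_one₀ hs0.le hs1)

/-- In the coordinates `y = p + v + s • e`, with `v` in the direction of the facet and `e = p₀ - p`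
transversal, `ν` is a multiple of the product of `τ` and Lebesgue measure. The slice at height `s`
is the facet shrunk by `s` towards `p`. -/
theorem exists_lintegral_facetCone_le {P F : Set E} {ℓ : E →ᵃ[ℝ] ℝ} (hF : IsFacet P F)
    (hFm : MeasurableSet F) (hFℓ : ∀ x ∈ F, ℓ x = 0) {p : E} (hp : 0 < ℓ p) (ν : Measure E)
    [ν.IsAddHaarMeasure] {σF : Measure E} (hσ : IsFlatMeasureOn F σF) :
    ∃ C : ℝ≥0∞, C ≠ ∞ ∧ ∀ g : E → ℝ≥0∞, Measurable g →
      ∫⁻ y in facetCone ℓ p F, g y ∂ν ≤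
        C * ∫⁻ x, (∫⁻ s in Ioc (0 : ℝ) 1, g (p + s • (x - p))) ∂σF := by
  obtain ⟨τ, p₀, hτ, hp₀, rfl⟩ := hσ
  let W := (affineSpan ℝ F).direction
  have hspan : ∀ x ∈ affineSpan ℝ F, ℓ x = 0 := by
    intro x hx
    have : affineSpan ℝ F ≤ (AffineSubspace.mk' (0 : ℝ) ⊥).comap ℓ := by
      rw [affineSpan_le]
      intro y hy
      simp [hFℓ y hy]
    simpa using this hx
  have hWker : ∀ w : W, ℓ.linear w = 0 := by
    intro w
    have h1 := ℓ.map_vadd p₀ (w : E)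
    rw [hspan _ hp₀, hspan _ (AffineSubspace.vadd_mem_of_mem_direction w.2 hp₀)] at h1
    simpa using h1.symm
  set e : E := p₀ - p with he
  have hℓe : ℓ.linear e = -ℓ p := by
    have := ℓ.linearMap_vsub p₀ p
    rw [hspan _ hp₀, vsub_eq_sub, vsub_eq_sub, zero_sub] at this
    exact this
  let Φ₀ : (W × ℝ) →ₗ[ℝ] E := W.subtype.coprod (LinearMap.toSpanSingleton ℝ E e)
  have hΦ₀ : ∀ v : W, ∀ s : ℝ, Φ₀ (v, s) = v + s • e := fun v s => by
    simp [Φ₀, LinearMap.coprod_apply]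
  have hℓΦ : ∀ (v : W) (s : ℝ), ℓ.linear (v + s • e) = -(s * ℓ p) := by
    intro v s
    simp [hWker, hℓe]
  have hinj : Function.Injective Φ₀ := by
    rw [injective_iff_map_eq_zero]
    rintro ⟨v, s⟩ h
    rw [hΦ₀] at h
    have h1 := hℓΦ v s
    rw [h, map_zero, zero_eq_neg, mul_eq_zero, or_iff_left hp.ne'] at h1
    subst h1
    simp only [zero_smul, add_zero, ZeroMemClass.coe_eq_zero] at h
    simp [h]
  have hfr : finrank ℝ (W × ℝ) = finrank ℝ E := by
    rw [finrank_prod, finrank_self]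
    exact hF.2.2
  let Φ : (W × ℝ) ≃L[ℝ] E :=
    (LinearEquiv.ofInjectiveOfFinrankEq Φ₀ hinj hfr).toContinuousLinearEquiv
  have hΦ : ∀ z : W × ℝ, Φ z = z.1 + z.2 • e := fun z => hΦ₀ z.1 z.2
  have hΦHaar : ((τ.prod volume).map Φ).IsAddHaarMeasure := Φ.isAddHaarMeasure_map _
  have hν : ν = ν.addHaarScalarFactor ((τ.prod volume).map Φ) • (τ.prod volume).map Φ :=
    Measure.isAddLeftInvariant_eq_smul _ _
  set c := ν.addHaarScalarFactor ((τ.prod volume).map Φ) with hc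
  refine ⟨c, ENNReal.coe_ne_top, fun g hg => ?_⟩
  have hKm := measurableSet_facetCone ℓ p hFm
  set K := facetCone ℓ p F with hK
  set G : E → ℝ≥0∞ := K.indicator g with hG
  have hGm : Measurable G := hg.indicator hKm
  have hΦm : Measurable Φ := Φ.continuous.measurable
  have hℓadd : ∀ w : E, ℓ (p + w) = ℓ p + ℓ.linear w := by
    intro w
    have := ℓ.map_vadd p w
    rw [vadd_eq_add, vadd_eq_add] at this
    rw [add_comm p, this, add_comm]
  -- The quantity `1 - ℓ y / ℓ p` in `facetCone` is the height: zero at the apex and one on the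
  -- facet.
  have hρ : ∀ (v : W) (s : ℝ), 1 - ℓ (p + (v + s • e)) / ℓ p = s := by
    intro v s
    rw [hℓadd, hℓΦ]
    field_simp
    ring
  have hinner : ∀ s : ℝ, ∫⁻ v : W, G (p + (v + s • e)) ∂τ ≤
      (Ioc (0 : ℝ) 1).indicator (fun s => ∫⁻ v : W, F.indicator
        (fun x => g (p + s • (x - p))) (v + p₀) ∂τ) s := by
    intro s
    by_cases hs : s ∈ Ioc (0 : ℝ) 1
    · rw [indicator_of_mem hs]
      have hm : Measurable fun v : W => G (p + (v + s • e)) := by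
        refine hGm.comp ?_
        fun_prop
      refine (lintegral_le_lintegral_comp_smul τ hs.1 hs.2 hm).trans (lintegral_mono fun v => ?_)
      have h1 : p + (((s • v : W) : E) + s • e) = p + s • (v + p₀ - p) := by
        rw [Submodule.coe_smul, he]; module
      by_cases hv : ((v : E) + p₀) ∈ F
      · rw [indicator_of_mem hv, h1, hG]
        exact indicator_le_self _ _ _
      · have : p + (((s • v : W) : E) + s • e) ∉ K := by
          rintro ⟨-, -, h⟩
          rw [hρ, h1] at h
          apply hv
          rwa [add_sub_cancel_left, smul_smul, inv_mul_cancel₀ hs.1.ne', one_smul,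
            add_sub_cancel] at h
        simp only [hG]
        rw [indicator_of_notMem this]
        exact zero_le
    · rw [indicator_of_notMem hs]
      refine (lintegral_eq_zero_of_ae_eq_zero (Eventually.of_forall fun v => ?_)).le
      refine indicator_of_notMem ?_ _
      rintro ⟨h1, h2, -⟩
      rw [hρ] at h1 h2
      exact hs ⟨h1, h2⟩
  have hmeas2 : Measurable fun q : E × ℝ => g (p + q.2 • (q.1 - p)) := by
    refine hg.comp ?_
    fun_prop
  have hmeas3 : Measurable fun q : W × ℝ =>
      F.indicator (fun x => g (p + q.2 • (x - p))) (q.1 + p₀) := by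
    have hset : MeasurableSet {q : E × ℝ | q.1 ∈ F} := measurable_fst hFm
    have h1 := hmeas2.indicator hset
    have h2 : Measurable fun q : W × ℝ => ((q.1 : E) + p₀, q.2) := by fun_prop
    exact h1.comp h2
  calc ∫⁻ y in K, g y ∂ν = ∫⁻ y, G y ∂ν := (lintegral_indicator hKm g).symm
    _ = ∫⁻ y, G (p + y) ∂ν := (lintegral_add_left_eq_self G p).symm
    _ = c * ∫⁻ z, G (p + Φ z) ∂(τ.prod volume) := by
      conv_lhs => rw [hν]
      have hm : Measurable fun y => G (p + y) := hGm.comp (measurable_const_add p)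
      rw [lintegral_smul_measure, lintegral_map hm hΦm]
      rfl
    _ = c * ∫⁻ s : ℝ, ∫⁻ v : W, G (p + (v + s • e)) ∂τ := by
      simp_rw [hΦ]
      rw [lintegral_prod_symm']
      exact hGm.comp (by fun_prop)
    _ ≤ c * ∫⁻ s in Ioc (0 : ℝ) 1, ∫⁻ v : W, F.indicator
        (fun x => g (p + s • (x - p))) (v + p₀) ∂τ := by
      refine mul_le_mul_right ?_ _
      rw [← lintegral_indicator measurableSet_Ioc]
      exact lintegral_mono hinner
    _ = c * ∫⁻ v : W, (∫⁻ s in Ioc (0 : ℝ) 1, F.indicator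
        (fun x => g (p + s • (x - p))) (v + p₀)) ∂τ := by
      rw [lintegral_lintegral_swap]
      exact (hmeas3.comp measurable_swap).aemeasurable
    _ = c * ∫⁻ v : W, F.indicator (fun x => ∫⁻ s in Ioc (0 : ℝ) 1, g (p + s • (x - p)))
        (v + p₀) ∂τ := by
      congr 2 with v
      by_cases hv : (v : E) + p₀ ∈ F <;> simp [hv]
    _ = _ := by
      have hm : Measurable fun x => ∫⁻ s in Ioc (0 : ℝ) 1, g (p + s • (x - p)) :=
        hmeas2.lintegral_prod_right'
      rw [← lintegral_indicator hFm, lintegral_map (hm.indicator hFm) (by fun_prop)]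

end Cone

namespace System

variable {E : Type*} [NormedAddCommGroup E] [NormedSpace ℝ E] [MeasurableSpace E] (𝒮 : System E)

theorem isCompact_P : IsCompact 𝒮.P := 𝒮.simple.1.1

theorem convex_P : Convex ℝ 𝒮.P := 𝒮.simple.1.convex

variable [BorelSpace E]

theorem measurableSet_P : MeasurableSet 𝒮.P := 𝒮.isCompact_P.isClosed.measurableSet

variable [FiniteDimensional ℝ E]

/-- A ray from `p` leaves `P` at a frontier point, which lies on a facet, so the point `p` and
finitely many facet cones cover `P`. The term `g p` matters only in dimension zero, where `{p}` has
positive mass. -/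
theorem exists_lintegral_le {p : E} (hp : p ∈ interior 𝒮.P) :
    ∃ C : ℝ≥0∞, C ≠ ∞ ∧ ∀ g : E → ℝ≥0∞, Measurable g →
      ∫⁻ y, g y ∂𝒮.μ ≤ C * (g p + ∫⁻ x, (∫⁻ s in Ioc (0 : ℝ) 1, g (p + s • (x - p))) ∂𝒮.σ) := by
  classical
  obtain ⟨ν, hν, hμ⟩ := 𝒮.flat_μ
  obtain ⟨L, hLfin, hL0, hLP⟩ := 𝒮.simple.1.exists_affine
  have hpos : ∀ ℓ ∈ L, 0 < ℓ p := fun ℓ hℓ => affine_pos_of_mem_interior (hL0 ℓ hℓ)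
    (fun x hx => by rw [hLP] at hx; exact hx ℓ hℓ) hp
  have hcl : IsClosed 𝒮.P := 𝒮.isCompact_P.isClosed
  let F : (E →ᵃ[ℝ] ℝ) → Set E := fun ℓ => {y ∈ 𝒮.P | ℓ y = 0}
  have hFm : ∀ ℓ, MeasurableSet (F ℓ) := fun ℓ =>
    (hcl.inter (isClosed_singleton.preimage ℓ.continuous_of_finiteDimensional)).measurableSet
  let T := (hLfin.subset (sep_subset L fun ℓ => IsFacet 𝒮.P (F ℓ))).toFinset
  have hT : ∀ ℓ, ℓ ∈ T ↔ ℓ ∈ L ∧ IsFacet 𝒮.P (F ℓ) := fun ℓ => by simp [T]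
  have hex : ∀ ℓ, ∃ C : ℝ≥0∞, C ≠ ∞ ∧ (ℓ ∈ T → ∀ g : E → ℝ≥0∞, Measurable g →
      ∫⁻ y in facetCone ℓ p (F ℓ), g y ∂ν ≤
        C * ∫⁻ x, (∫⁻ s in Ioc (0 : ℝ) 1, g (p + s • (x - p))) ∂(𝒮.σ.restrict (F ℓ))) := by
    intro ℓ
    by_cases h : ℓ ∈ T
    · have h' := (hT ℓ).1 h
      obtain ⟨C, hC, hCg⟩ := exists_lintegral_facetCone_le h'.2 (hFm ℓ) (fun x hx => hx.2)
        (hpos ℓ h'.1) ν (𝒮.flat_σ _ h'.2)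
      exact ⟨C, hC, fun _ => hCg⟩
    · exact ⟨0, by simp, fun h' => absurd h' h⟩
  choose C hC hCg using hex
  have hcover : 𝒮.P ⊆ {p} ∪ ⋃ ℓ ∈ T, facetCone ℓ p (F ℓ) := by
    intro y hy
    by_cases hyp : y = p
    · exact Or.inl hyp
    refine Or.inr ?_
    obtain ⟨R, hR⟩ := 𝒮.isCompact_P.isBounded.subset_ball p
    have hn : 0 < ‖y - p‖ := norm_pos_iff.2 (sub_ne_zero.2 hyp)
    have hyR : ‖y - p‖ < R := by simpa [dist_eq_norm] using hR hy
    set N : ℝ := R / ‖y - p‖ with hN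
    have hN1 : 1 < N := by rw [hN, one_lt_div hn]; exact hyR
    have hz : p + N • (y - p) ∉ 𝒮.P := by
      intro hz
      have := hR hz
      rw [Metric.mem_ball, dist_eq_norm, add_sub_cancel_left, norm_smul, Real.norm_eq_abs,
        abs_of_pos (by linarith), hN, div_mul_cancel₀ _ hn.ne'] at this
      exact lt_irrefl _ this
    obtain ⟨w, hw, hwf⟩ := exists_mem_segment_frontier hy hz
    obtain ⟨ℓ, hℓ, hℓw, hfac⟩ := exists_isFacet_of_mem_frontier hLfin hL0 hLP ⟨p, hp⟩ hwf
    refine mem_iUnion₂.2 ⟨ℓ, (hT ℓ).2 ⟨hℓ, hfac⟩, ?_⟩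
    obtain ⟨a, b, ha, hb, hab, rfl⟩ := hw
    -- The exit point is `p + t • (y - p)` with `t ≥ 1`, so `y` sits at height `t⁻¹` in the cone.
    set t := a + b * N with ht
    have ht1 : 1 ≤ t := by nlinarith
    have hw' : a • y + b • (p + N • (y - p)) = p + t • (y - p) := by
      have : a = 1 - b := by linarith
      rw [ht, this]; module
    rw [hw'] at hℓw hwf
    have hℓy : ℓ (p + t • (y - p)) = ℓ p + t * (ℓ y - ℓ p) := by
      have := ℓ.apply_lineMap p y t
      rw [AffineMap.lineMap_apply, AffineMap.lineMap_apply] at this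
      simp only [vsub_eq_sub, vadd_eq_add, smul_eq_mul] at this
      rw [add_comm p, this]; ring
    have h0 := hpos ℓ hℓ
    have hρ : 1 - ℓ y / ℓ p = t⁻¹ := by
      rw [hℓw] at hℓy
      field_simp
      linarith
    have ht0 : 0 < t := by linarith
    refine ⟨?_, ?_, ?_⟩
    · rw [hρ]; positivity
    · rw [hρ]; exact inv_le_one_of_one_le₀ ht1
    · rw [hρ, inv_inv]; exact ⟨hcl.frontier_subset hwf, hℓw⟩
  have hunion : ∀ (T' : Finset (E →ᵃ[ℝ] ℝ)) (g : E → ℝ≥0∞),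
      ∫⁻ y in ⋃ ℓ ∈ T', facetCone ℓ p (F ℓ), g y ∂ν ≤
        ∑ ℓ ∈ T', ∫⁻ y in facetCone ℓ p (F ℓ), g y ∂ν := by
    intro T' g
    induction T' using Finset.induction_on with
    | empty => simp
    | insert a s ha ih =>
      rw [Finset.sum_insert ha, Finset.set_biUnion_insert]
      exact (lintegral_union_le _ _ _).trans (by gcongr)
  refine ⟨ν {p} + ∑ ℓ ∈ T, C ℓ, ?_, fun g hg => ?_⟩
  · exact ENNReal.add_ne_top.2 ⟨(isCompact_singleton.measure_lt_top).ne,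
      ENNReal.sum_ne_top.2 fun ℓ _ => hC ℓ⟩
  set I := ∫⁻ x, (∫⁻ s in Ioc (0 : ℝ) 1, g (p + s • (x - p))) ∂𝒮.σ with hI
  calc ∫⁻ y, g y ∂𝒮.μ = ∫⁻ y in 𝒮.P, g y ∂ν := by rw [hμ]
    _ ≤ ∫⁻ y in {p} ∪ ⋃ ℓ ∈ T, facetCone ℓ p (F ℓ), g y ∂ν := lintegral_mono_set hcover
    _ ≤ ∫⁻ y in {p}, g y ∂ν + ∑ ℓ ∈ T, ∫⁻ y in facetCone ℓ p (F ℓ), g y ∂ν :=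
      (lintegral_union_le _ _ _).trans (add_le_add le_rfl (hunion T g))
    _ ≤ ν {p} * g p + ∑ ℓ ∈ T, C ℓ * I := by
      gcongr with ℓ hℓ
      · rw [lintegral_singleton, mul_comm]
      · refine (hCg ℓ hℓ g hg).trans ?_
        exact mul_le_mul_right (lintegral_mono' Measure.restrict_le_self le_rfl) _
    _ = ν {p} * g p + (∑ ℓ ∈ T, C ℓ) * I := by rw [Finset.sum_mul]
    _ ≤ _ := by
      rw [mul_add, add_mul, add_mul]
      refine add_le_add (le_add_right le_rfl) (le_add_left le_rfl)

/-- The frontier carries `σ` and is covered by finitely many compact facets, on each of which a flat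
measure is finite. -/
theorem σ_univ_ne_top : 𝒮.σ univ ≠ ∞ := by
  obtain ⟨L, hLfin, hL0, hLP⟩ := 𝒮.simple.1.exists_affine
  have hcl : IsClosed 𝒮.P := 𝒮.isCompact_P.isClosed
  have hcover : frontier 𝒮.P ⊆
      ⋃ ℓ ∈ {ℓ ∈ L | IsFacet 𝒮.P {y ∈ 𝒮.P | ℓ y = 0}}, {y ∈ 𝒮.P | ℓ y = 0} := by
    intro x hx
    obtain ⟨ℓ, hℓ, hℓx, hfac⟩ :=
      exists_isFacet_of_mem_frontier hLfin hL0 hLP 𝒮.simple.1.2.1 hx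
    exact mem_iUnion₂.2 ⟨ℓ, ⟨hℓ, hfac⟩, hcl.frontier_subset hx, hℓx⟩
  have h1 : 𝒮.σ univ ≤ 𝒮.σ (frontier 𝒮.P) + 𝒮.σ (frontier 𝒮.P)ᶜ := by
    rw [← union_compl_self (frontier 𝒮.P)]
    exact measure_union_le _ _
  rw [𝒮.σ_compl, add_zero] at h1
  refine ((h1.trans (measure_mono hcover)).trans_lt ?_).ne
  refine measure_biUnion_lt_top (hLfin.subset (sep_subset _ _)) fun ℓ hℓ => ?_
  obtain ⟨τ, p, hτ, hp, hστ⟩ := 𝒮.flat_σ _ hℓ.2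
  have hFc : IsCompact {y ∈ 𝒮.P | ℓ y = 0} := 𝒮.isCompact_P.inter_right
    (isClosed_singleton.preimage ℓ.continuous_of_finiteDimensional)
  have h2 : 𝒮.σ {y ∈ 𝒮.P | ℓ y = 0} = (𝒮.σ.restrict {y ∈ 𝒮.P | ℓ y = 0}) {y ∈ 𝒮.P | ℓ y = 0} :=
    (Measure.restrict_apply_self _ _).symm
  rw [h2, hστ, Measure.restrict_apply_self, Measure.map_apply (by fun_prop) hFc.measurableSet]
  refine IsCompact.measure_lt_top ?_
  have hemb : Topology.IsClosedEmbedding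
      (fun v : (affineSpan ℝ {y ∈ 𝒮.P | ℓ y = 0}).direction => (v : E) + p) :=
    (Homeomorph.addRight p).isClosedEmbedding.comp
      (Submodule.closed_of_finiteDimensional _).isClosedEmbedding_subtypeVal
  exact hemb.isCompact_preimage hFc

end System
end MuEntropy

/-! ### Log convex functions, the mean value inequality, and states in the interior. -/

namespace MuEntropy

theorem ennreal_geom_mean_le_arith_mean {t : ℝ} (ht0 : 0 ≤ t) (ht1 : t ≤ 1) (a b : ℝ≥0∞) :
    a ^ (1 - t) * b ^ t ≤ ENNReal.ofReal (1 - t) * a + ENNReal.ofReal t * b := by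
  rcases ht0.eq_or_lt with rfl | ht0
  · simp
  rcases ht1.eq_or_lt with rfl | ht1
  · simp
  have h1 : 0 < 1 - t := by linarith
  rcases eq_or_ne a ∞ with rfl | ha
  · rw [ENNReal.mul_top (by simpa using h1), top_add]; exact le_top
  rcases eq_or_ne b ∞ with rfl | hb
  · rw [ENNReal.mul_top (by simpa using ht0), add_top]; exact le_top
  lift a to NNReal using ha
  lift b to NNReal using hb
  have := NNReal.geom_mean_le_arith_mean2_weighted (1 - t).toNNReal t.toNNReal a b (by
    rw [← Real.toNNReal_add h1.le ht0.le]; simp)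
  rw [Real.coe_toNNReal _ h1.le, Real.coe_toNNReal _ ht0.le] at this
  rw [← ENNReal.coe_rpow_of_nonneg _ h1.le, ← ENNReal.coe_rpow_of_nonneg _ ht0.le]
  simp only [ENNReal.ofReal]
  exact_mod_cast this

/-- Hölder's inequality on two points with exponents `1 / (1 - t)` and `1 / t`. It makes sums of log
convex functions log convex. -/
theorem ennreal_add_rpow_mul_rpow_le {t : ℝ} (ht0 : 0 ≤ t) (ht1 : t ≤ 1) (a b c d : ℝ≥0∞) :
    a ^ (1 - t) * b ^ t + c ^ (1 - t) * d ^ t ≤ (a + c) ^ (1 - t) * (b + d) ^ t := by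
  rcases ht0.eq_or_lt with rfl | ht0
  · simp
  rcases ht1.eq_or_lt with rfl | ht1
  · simp
  have h1 : 0 < 1 - t := by linarith
  have hpq : (1 - t)⁻¹.HolderConjugate t⁻¹ := by
    rw [Real.holderConjugate_iff]
    exact ⟨by rw [one_lt_inv₀ h1]; linarith, by simp⟩
  have := ENNReal.inner_le_Lp_mul_Lq Finset.univ ![a ^ (1 - t), c ^ (1 - t)] ![b ^ t, d ^ t] hpq
  simpa [Fin.sum_univ_two, ENNReal.rpow_rpow_inv h1.ne', ENNReal.rpow_rpow_inv ht0.ne'] using this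

section Convexity

variable {E : Type*} [NormedAddCommGroup E] [NormedSpace ℝ E]

/-- Log convexity on a set, for functions with values in `[0, ∞]`. -/
def LogConvexOn (s : Set E) (f : E → ℝ≥0∞) : Prop :=
  ∀ x ∈ s, ∀ y ∈ s, ∀ t : ℝ, 0 ≤ t → t ≤ 1 → f ((1 - t) • x + t • y) ≤ f x ^ (1 - t) * f y ^ t

/-- Convexity on a set, for functions with values in `[0, ∞]`. -/
def EConvexOn (s : Set E) (f : E → ℝ≥0∞) : Prop :=
  ∀ x ∈ s, ∀ y ∈ s, ∀ t : ℝ, 0 ≤ t → t ≤ 1 →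
    f ((1 - t) • x + t • y) ≤ ENNReal.ofReal (1 - t) * f x + ENNReal.ofReal t * f y

theorem LogConvexOn.eConvexOn {s : Set E} {f : E → ℝ≥0∞} (hf : LogConvexOn s f) :
    EConvexOn s f := fun x hx y hy t ht0 ht1 =>
  (hf x hx y hy t ht0 ht1).trans (ennreal_geom_mean_le_arith_mean ht0 ht1 _ _)

theorem LogConvexOn.mono {s t : Set E} {f : E → ℝ≥0∞} (hf : LogConvexOn s f) (h : t ⊆ s) :
    LogConvexOn t f := fun x hx y hy => hf x (h hx) y (h hy)

theorem EConvexOn.mono {s t : Set E} {f : E → ℝ≥0∞} (hf : EConvexOn s f) (h : t ⊆ s) :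
    EConvexOn t f := fun x hx y hy => hf x (h hx) y (h hy)

theorem EConvexOn.convexOn_toReal {s : Set E} {f : E → ℝ≥0∞} (hf : EConvexOn s f)
    (hs : Convex ℝ s) (hfin : ∀ x ∈ s, f x ≠ ∞) : ConvexOn ℝ s fun x => (f x).toReal := by
  refine ⟨hs, fun x hx y hy a b ha hb hab => ?_⟩
  obtain rfl : a = 1 - b := by linarith
  have h1 := hf x hx y hy b hb (by linarith)
  have h2 : ENNReal.ofReal (1 - b) * f x + ENNReal.ofReal b * f y ≠ ∞ :=
    ENNReal.add_ne_top.2 ⟨ENNReal.mul_ne_top ENNReal.ofReal_ne_top (hfin x hx),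
      ENNReal.mul_ne_top ENNReal.ofReal_ne_top (hfin y hy)⟩
  have h3 := ENNReal.toReal_mono h2 h1
  rw [ENNReal.toReal_add (ENNReal.mul_ne_top ENNReal.ofReal_ne_top (hfin x hx))
    (ENNReal.mul_ne_top ENNReal.ofReal_ne_top (hfin y hy)), ENNReal.toReal_mul,
    ENNReal.toReal_mul, ENNReal.toReal_ofReal ha, ENNReal.toReal_ofReal hb] at h3
  simpa using h3

variable [FiniteDimensional ℝ E]

theorem EConvexOn.continuousOn {s : Set E} {f : E → ℝ≥0∞} (hf : EConvexOn s f)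
    (hs : Convex ℝ s) (hso : IsOpen s) (hfin : ∀ x ∈ s, f x ≠ ∞) : ContinuousOn f s := by
  have h := ENNReal.continuous_ofReal.comp_continuousOn
    ((hf.convexOn_toReal hs hfin).continuousOn hso)
  exact h.congr fun x hx => (ENNReal.ofReal_toReal (hfin x hx)).symm

/-- The mean value inequality for convex functions. -/
theorem exists_forall_eConvexOn_le [MeasurableSpace E] [BorelSpace E] (ν : Measure E)
    [ν.IsAddHaarMeasure] {s : Set E} {y : E} (hy : y ∈ interior s) :
    ∃ C : ℝ≥0∞, C ≠ ∞ ∧ ∀ f : E → ℝ≥0∞, Measurable f → EConvexOn s f →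
      f y ≤ C * ∫⁻ x in s, f x ∂ν := by
  obtain ⟨r, hr, hball⟩ := Metric.mem_nhds_iff.1 (mem_interior_iff_mem_nhds.1 hy)
  set B := Metric.ball y r with hB
  have hBm : MeasurableSet B := measurableSet_ball
  have hB0 : ν B ≠ 0 := (Metric.measure_ball_pos ν y hr).ne'
  have hB1 : ν B ≠ ∞ := measure_ball_lt_top.ne
  refine ⟨(ν B)⁻¹, ENNReal.inv_ne_top.2 hB0, fun f hf hconv => ?_⟩
  -- The point reflection in `y` preserves the ball and `ν`, and convexity bounds `f y` by the mean
  -- of `f` at `x` and at its reflection.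
  have hrefl : ∀ x, y + y - x ∈ B ↔ x ∈ B := by
    intro x
    rw [hB, Metric.mem_ball, Metric.mem_ball, dist_eq_norm, dist_eq_norm, ← norm_neg]
    congr! 2
    abel
  have h1 : ∫⁻ x in B, f (y + y - x) ∂ν = ∫⁻ x in B, f x ∂ν := by
    rw [← lintegral_indicator hBm, ← lintegral_indicator hBm,
      ← lintegral_sub_left_eq_self (B.indicator f) (y + y)]
    refine lintegral_congr fun x => ?_
    by_cases hx : x ∈ B
    · rw [indicator_of_mem hx, indicator_of_mem ((hrefl x).2 hx)]
    · rw [indicator_of_notMem hx, indicator_of_notMem (mt (hrefl x).1 hx)]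
  have h2 : f y * ν B ≤ ∫⁻ x in B, f x ∂ν := by
    calc f y * ν B = ∫⁻ _ in B, f y ∂ν := by simp
      _ ≤ ∫⁻ x in B, (ENNReal.ofReal (1 - 1 / 2) * f x
            + ENNReal.ofReal (1 / 2) * f (y + y - x)) ∂ν := by
        refine setLIntegral_mono' hBm fun x hx => ?_
        have := hconv x (hball hx) (y + y - x) (hball ((hrefl x).2 hx)) (1 / 2) (by norm_num)
          (by norm_num)
        have e : (1 - 1 / 2 : ℝ) • x + (1 / 2 : ℝ) • (y + y - x) = y := by module
        rwa [e] at this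
      _ = ∫⁻ x in B, f x ∂ν := by
        rw [lintegral_add_left (by fun_prop), lintegral_const_mul _ hf,
          lintegral_const_mul _ (by fun_prop), h1, ← add_mul, ← ENNReal.ofReal_add (by norm_num)
          (by norm_num)]
        norm_num
  calc f y = (ν B)⁻¹ * (f y * ν B) := by
        rw [mul_comm (f y), ← mul_assoc, ENNReal.inv_mul_cancel hB0 hB1, one_mul]
    _ ≤ (ν B)⁻¹ * ∫⁻ x in s, f x ∂ν := by
      gcongr
      exact h2.trans (lintegral_mono_set hball)

end Convexity

namespace System

variable {E : Type*} [NormedAddCommGroup E] [NormedSpace ℝ E] [MeasurableSpace E] (𝒮 : System E)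

/-- The extension by zero of a function on `P` to the ambient space. -/
noncomputable def ext (u : 𝒮.P → ℝ≥0∞) : E → ℝ≥0∞ := Function.extend Subtype.val u 0

variable {𝒮}

@[simp]
theorem ext_coe (u : 𝒮.P → ℝ≥0∞) (x : 𝒮.P) : 𝒮.ext u x = u x :=
  Subtype.val_injective.extend_apply _ _ _

theorem ext_of_mem (u : 𝒮.P → ℝ≥0∞) {x : E} (hx : x ∈ 𝒮.P) : 𝒮.ext u x = u ⟨x, hx⟩ :=
  ext_coe u ⟨x, hx⟩

theorem IsState.logConvexOn_ext {u : 𝒮.P → ℝ≥0∞} (hu : 𝒮.IsState u) :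
    LogConvexOn 𝒮.P (𝒮.ext u) := by
  intro x hx y hy t ht0 ht1
  have hz : (1 - t) • x + t • y ∈ 𝒮.P :=
    𝒮.convex_P hx hy (by linarith) ht0 (by ring)
  rw [ext_of_mem u hx, ext_of_mem u hy, ext_of_mem u hz]
  exact hu.logConvex ⟨x, hx⟩ ⟨y, hy⟩ ⟨_, hz⟩ t ht0 ht1 rfl

variable [BorelSpace E]

theorem IsState.measurable {u : 𝒮.P → ℝ≥0∞} (hu : 𝒮.IsState u) : Measurable u :=
  hu.lsc.measurable

theorem measurable_ext {u : 𝒮.P → ℝ≥0∞} (hu : Measurable u) : Measurable (𝒮.ext u) :=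
  (MeasurableEmbedding.subtype_coe 𝒮.measurableSet_P).measurable_extend hu measurable_const

theorem ae_mem_P_μ : ∀ᵐ x ∂𝒮.μ, x ∈ 𝒮.P := by
  obtain ⟨ν, -, hμ⟩ := 𝒮.flat_μ
  rw [hμ]
  exact ae_restrict_mem 𝒮.measurableSet_P

theorem ae_mem_P_σ : ∀ᵐ x ∂𝒮.σ, x ∈ 𝒮.P := by
  have h : ∀ᵐ x ∂𝒮.σ, x ∈ frontier 𝒮.P := 𝒮.σ_compl
  filter_upwards [h] with x hx using 𝒮.isCompact_P.isClosed.frontier_subset hx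

theorem lintegral_bulk (f : E → ℝ≥0∞) : ∫⁻ x, f x ∂𝒮.bulk = ∫⁻ x, f x ∂𝒮.μ := by
  rw [bulk, lintegral_subtype_comap 𝒮.measurableSet_P,
    Measure.restrict_eq_self_of_ae_mem ae_mem_P_μ]

theorem lintegral_bdry (f : E → ℝ≥0∞) : ∫⁻ x, f x ∂𝒮.bdry = ∫⁻ x, f x ∂𝒮.σ := by
  rw [bdry, lintegral_subtype_comap 𝒮.measurableSet_P,
    Measure.restrict_eq_self_of_ae_mem ae_mem_P_σ]

theorem bulk_univ : 𝒮.bulk univ = 𝒮.μ 𝒮.P := by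
  rw [bulk, (MeasurableEmbedding.subtype_coe 𝒮.measurableSet_P).comap_apply]
  simp

theorem bdry_univ : 𝒮.bdry univ = 𝒮.σ univ := by
  have := 𝒮.lintegral_bdry (fun _ => 1)
  simpa using this

variable [FiniteDimensional ℝ E]

theorem μ_P_ne_top : 𝒮.μ 𝒮.P ≠ ∞ := by
  obtain ⟨ν, hν, hμ⟩ := 𝒮.flat_μ
  rw [hμ, Measure.restrict_apply_self]
  exact 𝒮.isCompact_P.measure_lt_top.ne

theorem μ_P_ne_zero : 𝒮.μ 𝒮.P ≠ 0 := by
  obtain ⟨ν, hν, hμ⟩ := 𝒮.flat_μ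
  rw [hμ, Measure.restrict_apply_self]
  exact (Measure.measure_pos_of_nonempty_interior ν 𝒮.simple.1.2.1).ne'

instance : IsFiniteMeasure 𝒮.bulk := ⟨by rw [bulk_univ]; exact μ_P_ne_top.lt_top⟩

instance : IsFiniteMeasure 𝒮.bdry := ⟨by rw [bdry_univ]; exact 𝒮.σ_univ_ne_top.lt_top⟩

theorem IsState.lintegral_ext {u : 𝒮.P → ℝ≥0∞} (hu : 𝒮.IsState u) :
    ∫⁻ x, 𝒮.ext u x ∂𝒮.μ = 𝒮.μ 𝒮.P := by
  rw [← lintegral_bulk, ← hu.normalized]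
  simp

/-- States are locally uniformly bounded in the interior. -/
theorem exists_forall_isState_le {y : E} (hy : y ∈ interior 𝒮.P) :
    ∃ C : ℝ≥0∞, C ≠ ∞ ∧ ∀ u, 𝒮.IsState u → 𝒮.ext u y ≤ C := by
  obtain ⟨ν, hν, hμ⟩ := 𝒮.flat_μ
  obtain ⟨C, hC, h⟩ := exists_forall_eConvexOn_le ν hy
  refine ⟨C * 𝒮.μ 𝒮.P, ENNReal.mul_ne_top hC μ_P_ne_top, fun u hu => ?_⟩
  have := h _ (measurable_ext hu.measurable) hu.logConvexOn_ext.eConvexOn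
  rwa [← hμ, hu.lintegral_ext] at this

theorem IsState.ext_ne_top {u : 𝒮.P → ℝ≥0∞} (hu : 𝒮.IsState u) {y : E}
    (hy : y ∈ interior 𝒮.P) : 𝒮.ext u y ≠ ∞ := by
  obtain ⟨C, hC, h⟩ := exists_forall_isState_le hy
  exact ne_top_of_le_ne_top hC (h u hu)

/-- Two finite convex functions which agree almost everywhere agree in the interior. -/
theorem eqOn_interior_of_ae_eq {f g : E → ℝ≥0∞} (hf : EConvexOn (interior 𝒮.P) f)
    (hg : EConvexOn (interior 𝒮.P) g) (hf' : ∀ x ∈ interior 𝒮.P, f x ≠ ∞)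
    (hg' : ∀ x ∈ interior 𝒮.P, g x ≠ ∞) (hfg : f =ᵐ[𝒮.μ] g) : EqOn f g (interior 𝒮.P) := by
  obtain ⟨ν, hν, hμ⟩ := 𝒮.flat_μ
  have hc := 𝒮.convex_P.interior
  refine Measure.eqOn_open_of_ae_eq (μ := ν) ?_ isOpen_interior
    (hf.continuousOn hc isOpen_interior hf') (hg.continuousOn hc isOpen_interior hg')
  rw [hμ] at hfg
  exact ae_mono (Measure.restrict_mono_set _ interior_subset) hfg

/-- A state is determined by its values in the interior. -/
theorem IsState.le_of_eqOn_interior {u v : 𝒮.P → ℝ≥0∞} (hu : 𝒮.IsState u) (hv : 𝒮.IsState v)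
    (h : EqOn (𝒮.ext u) (𝒮.ext v) (interior 𝒮.P)) (x : 𝒮.P) : u x ≤ v x := by
  obtain ⟨p, hp⟩ := 𝒮.simple.1.2.1
  have hmem : ∀ r : ℝ, 0 ≤ r → r < 1 → (1 - r) • p + r • (x : E) ∈ interior 𝒮.P :=
    fun r h0 h1 => 𝒮.convex_P.combo_interior_self_mem_interior hp x.2 (by linarith) h0 (by ring)
  -- For `v x < c < u x`, semicontinuity keeps `u` above `c` near `x`, while convexity of `v` on the
  -- segment from `p` brings it below `c` near `x`; yet the two agree on the open segment.
  by_contra! hlt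
  obtain ⟨c, hvc, hcu⟩ := exists_between hlt
  have hmap : Tendsto (fun r : ℝ => (1 - r) • p + r • (x : E)) (𝓝[<] 1) (𝓝[𝒮.P] x) := by
    refine tendsto_nhdsWithin_iff.2 ⟨?_, ?_⟩
    · have : Continuous fun r : ℝ => (1 - r) • p + r • (x : E) := by fun_prop
      exact (this.tendsto' 1 _ (by simp)).mono_left nhdsWithin_le_nhds
    · filter_upwards [Ioo_mem_nhdsLT (zero_lt_one' ℝ)] with r hr
      exact interior_subset (hmem r hr.1.le hr.2)
  have h1 : ∀ᶠ y in 𝓝[𝒮.P] (x : E), c < 𝒮.ext u y := by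
    have := hu.lsc x c hcu
    rw [nhds_subtype_eq_comap_nhdsWithin, eventually_comap] at this
    filter_upwards [this, self_mem_nhdsWithin] with y hy hyP
    rw [ext_of_mem u hyP]
    exact hy ⟨y, hyP⟩ rfl
  have h2 : Tendsto (fun r : ℝ => ENNReal.ofReal (1 - r) * 𝒮.ext v p + ENNReal.ofReal r * v x)
      (𝓝[<] 1) (𝓝 (v x)) := by
    have h3 : Tendsto (fun r : ℝ => ENNReal.ofReal (1 - r)) (𝓝[<] 1) (𝓝 0) := by
      have : Continuous fun r : ℝ => ENNReal.ofReal (1 - r) :=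
        ENNReal.continuous_ofReal.comp (by fun_prop)
      exact (this.tendsto' 1 _ (by simp)).mono_left nhdsWithin_le_nhds
    have h4 : Tendsto (fun r : ℝ => ENNReal.ofReal r) (𝓝[<] 1) (𝓝 1) := by
      have : Continuous fun r : ℝ => ENNReal.ofReal r :=
        ENNReal.continuous_ofReal.comp (by fun_prop)
      exact (this.tendsto' 1 _ (by simp)).mono_left nhdsWithin_le_nhds
    have h5 := (ENNReal.Tendsto.mul_const h3 (Or.inr (hv.ext_ne_top hp))).add (b := 1 * v x)
      (ENNReal.Tendsto.mul_const (b := v x) h4 (Or.inl one_ne_zero))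
    simpa using h5
  obtain ⟨r, ⟨hr1, hr2⟩, hr3⟩ := (((hmap.eventually h1).and
    (h2.eventually (gt_mem_nhds hvc))).and (Ioo_mem_nhdsLT (zero_lt_one' ℝ))).exists
  rw [h (hmem r hr3.1.le hr3.2)] at hr1
  have h6 := hv.logConvexOn_ext.eConvexOn p (interior_subset hp) x x.2 r hr3.1.le hr3.2.le
  rw [ext_coe] at h6
  exact lt_irrefl _ (hr1.trans_le (h6.trans hr2.le))

/-- Finite convex functions are continuous in the interior, so the two agree there, and radial
limits determine the boundary values. -/
theorem IsState.eq_of_ae_eq {u v : 𝒮.P → ℝ≥0∞} (hu : 𝒮.IsState u) (hv : 𝒮.IsState v)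
    (h : u =ᵐ[𝒮.bulk] v) : u = v := by
  have h1 : 𝒮.ext u =ᵐ[𝒮.μ] 𝒮.ext v := by
    have h2 : ∀ᵐ x ∂(𝒮.bulk.map Subtype.val), 𝒮.ext u x = 𝒮.ext v x := by
      refine (ae_map_iff measurable_subtype_coe.aemeasurable (measurableSet_eq_fun
        (measurable_ext hu.measurable) (measurable_ext hv.measurable))).2 ?_
      filter_upwards [h] with x hx
      simpa using hx
    rw [bulk, map_comap_subtype_coe 𝒮.measurableSet_P,
      Measure.restrict_eq_self_of_ae_mem ae_mem_P_μ] at h2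
    exact h2
  have h2 := eqOn_interior_of_ae_eq (hu.logConvexOn_ext.eConvexOn.mono interior_subset)
    (hv.logConvexOn_ext.eConvexOn.mono interior_subset) (fun _ => hu.ext_ne_top)
    (fun _ => hv.ext_ne_top) h1
  exact funext fun x => le_antisymm (hu.le_of_eqOn_interior hv h2 x)
    (hv.le_of_eqOn_interior hu h2.symm x)

end System
end MuEntropy

/-! ### The positive part of `u log u` is controlled by the energy. -/

namespace MuEntropy

/-- The positive part of `a log a`. -/
noncomputable def mulLogPos (a : ℝ≥0∞) : ℝ≥0∞ := ((a : EReal) * ENNReal.log a).toENNReal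

/-- The negative part of `a log a`. -/
noncomputable def mulLogNeg (a : ℝ≥0∞) : ℝ≥0∞ := (-((a : EReal) * ENNReal.log a)).toENNReal

/-- At `v = 0` the conventions agree: `0 * ⊥ = 0` in `EReal`, and `Real.log 0 = 0`. -/
theorem coe_mul_log_ofReal {v : ℝ} (hv : 0 ≤ v) :
    ((ENNReal.ofReal v : ℝ≥0∞) : EReal) * ENNReal.log (ENNReal.ofReal v) =
      ((v * Real.log v : ℝ) : EReal) := by
  rcases hv.eq_or_lt with rfl | hv
  · simp
  · rw [ENNReal.log_ofReal_of_pos hv, EReal.coe_ennreal_ofReal, max_eq_left hv.le, EReal.coe_mul]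

theorem mulLogPos_ofReal {v : ℝ} (hv : 0 ≤ v) :
    mulLogPos (ENNReal.ofReal v) = ENNReal.ofReal (v * Real.log v) := by
  rw [mulLogPos, coe_mul_log_ofReal hv, EReal.toENNReal_of_ne_top (EReal.coe_ne_top _),
    EReal.toReal_coe]

theorem mulLogNeg_ofReal {v : ℝ} (hv : 0 ≤ v) :
    mulLogNeg (ENNReal.ofReal v) = ENNReal.ofReal (-(v * Real.log v)) := by
  rw [mulLogNeg, coe_mul_log_ofReal hv, ← EReal.coe_neg,
    EReal.toENNReal_of_ne_top (EReal.coe_ne_top _), EReal.toReal_coe]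

theorem mulLogPos_mono : Monotone mulLogPos := by
  intro a b hab
  rcases le_total a 1 with ha | ha
  · have : (a : EReal) * ENNReal.log a ≤ 0 :=
      mul_nonpos_of_nonneg_of_nonpos (EReal.coe_ennreal_nonneg a) (ENNReal.log_le_zero_iff.2 ha)
    rw [mulLogPos, EReal.toENNReal_of_nonpos this]
    exact zero_le
  · refine EReal.toENNReal_le_toENNReal ?_
    exact mul_le_mul (EReal.coe_ennreal_le_coe_ennreal_iff.2 hab) (ENNReal.log_le_log hab)
      (ENNReal.zero_le_log_iff.2 ha) (EReal.coe_ennreal_nonneg b)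

/-- Since `V ^ s * log V` is the derivative of `V ^ s`, integration absorbs the logarithm and leaves
a bound linear in `V`, not of size `V log V`. -/
theorem mulLogPos_lintegral_rpow_le {A V : ℝ} (hA : 1 ≤ A) (hV : 1 ≤ V) :
    ∫⁻ s in Ioc (0 : ℝ) 1, mulLogPos (ENNReal.ofReal (A * V ^ s)) ≤
      ENNReal.ofReal (A * Real.log A + A) * ENNReal.ofReal V := by
  have hA0 : 0 < A := by linarith
  have hV0 : 0 < V := by linarith
  have hlA : 0 ≤ Real.log A := Real.log_nonneg hA
  have hlV : 0 ≤ Real.log V := Real.log_nonneg hV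
  have hpow : Continuous fun s : ℝ => V ^ s := Real.continuous_const_rpow hV0.ne'
  have hpt : ∀ s ∈ Ioc (0 : ℝ) 1, mulLogPos (ENNReal.ofReal (A * V ^ s)) ≤
      ENNReal.ofReal (A * Real.log A * V + A * (V ^ s * Real.log V)) := by
    intro s hs
    have hVs : 0 < V ^ s := Real.rpow_pos_of_pos hV0 s
    rw [mulLogPos_ofReal (by positivity)]
    refine ENNReal.ofReal_le_ofReal ?_
    rw [Real.log_mul hA0.ne' hVs.ne', Real.log_rpow hV0]
    have h1 : V ^ s ≤ V := by
      simpa using Real.rpow_le_rpow_of_exponent_le hV hs.2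
    have h2 : s * Real.log V ≤ Real.log V := mul_le_of_le_one_left hlV hs.2
    have h3 : A * V ^ s * Real.log A ≤ A * Real.log A * V := by
      have := mul_le_mul_of_nonneg_left h1 (mul_nonneg hA0.le hlA)
      linarith
    have h4 : A * V ^ s * (s * Real.log V) ≤ A * (V ^ s * Real.log V) := by
      have := mul_le_mul_of_nonneg_left h2 (mul_nonneg hA0.le hVs.le)
      linarith
    linarith
  have hcont : Continuous fun s : ℝ => A * Real.log A * V + A * (V ^ s * Real.log V) := by
    fun_prop
  have hFTC : ∫ s in (0 : ℝ)..1, (A * Real.log A * V + A * (V ^ s * Real.log V)) =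
      A * Real.log A * V + A * (V - 1) := by
    have h := intervalIntegral.integral_eq_sub_of_hasDerivAt
      (f := fun s : ℝ => A * Real.log A * V * s + A * V ^ s)
      (f' := fun s : ℝ => A * Real.log A * V + A * (V ^ s * Real.log V)) (a := 0) (b := 1)
      (fun s _ => by
        have h1 := (hasDerivAt_id s).const_mul (A * Real.log A * V)
        have h2 := ((Real.hasStrictDerivAt_const_rpow hV0 s).hasDerivAt).const_mul A
        simpa using h1.fun_add h2) (hcont.intervalIntegrable _ _)
    rw [h]
    simp
    ring
  calc ∫⁻ s in Ioc (0 : ℝ) 1, mulLogPos (ENNReal.ofReal (A * V ^ s))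
      ≤ ∫⁻ s in Ioc (0 : ℝ) 1, ENNReal.ofReal (A * Real.log A * V + A * (V ^ s * Real.log V)) :=
        setLIntegral_mono' measurableSet_Ioc hpt
    _ = ENNReal.ofReal (∫ s in Ioc (0 : ℝ) 1,
          (A * Real.log A * V + A * (V ^ s * Real.log V))) := by
      refine (ofReal_integral_eq_lintegral_ofReal ?_ ?_).symm
      · exact (hcont.intervalIntegrable 0 1).1
      · refine Eventually.of_forall fun s => ?_
        have hVs : 0 < V ^ s := Real.rpow_pos_of_pos hV0 s
        positivity
    _ = ENNReal.ofReal (A * Real.log A * V + A * (V - 1)) := by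
      rw [← intervalIntegral.integral_of_le zero_le_one, hFTC]
    _ ≤ ENNReal.ofReal (A * Real.log A + A) * ENNReal.ofReal V := by
      rw [← ENNReal.ofReal_mul (by positivity)]
      refine ENNReal.ofReal_le_ofReal ?_
      nlinarith

namespace System

variable {E : Type*} [NormedAddCommGroup E] [NormedSpace ℝ E] [MeasurableSpace E] {𝒮 : System E}
  [BorelSpace E] [FiniteDimensional ℝ E]

variable (𝒮) in
/-- The entropy of a state is controlled by its energy. -/
theorem exists_lintegral_mulLogPos_le : ∃ K : ℝ≥0∞, K ≠ ∞ ∧ ∀ u, 𝒮.IsState u →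
    ∫⁻ x, mulLogPos (u x) ∂𝒮.bulk ≤ K * (1 + ∫⁻ x, u x ∂𝒮.bdry) := by
  obtain ⟨p, hp⟩ := 𝒮.simple.1.2.1
  obtain ⟨A', hA', hA'u⟩ := exists_forall_isState_le hp
  obtain ⟨C, hC, hCg⟩ := 𝒮.exists_lintegral_le hp
  -- One bound at `p` serves all states; `A ≥ 1` makes `A ^ (1 - s) ≤ A` and keeps `log A`
  -- non-negative.
  set A : ℝ := max A'.toReal 1 with hA
  have hA1 : 1 ≤ A := le_max_right _ _
  have hAu : ∀ u, 𝒮.IsState u → 𝒮.ext u p ≤ ENNReal.ofReal A := fun u hu =>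
    (hA'u u hu).trans (ENNReal.le_ofReal_iff_toReal_le hA' (by linarith) |>.2 (le_max_left _ _))
  set D : ℝ≥0∞ := ENNReal.ofReal (A * Real.log A + A) with hD
  have hD0 : 0 < A * Real.log A + A := by
    have := Real.log_nonneg hA1
    positivity
  have hline : ∀ u, 𝒮.IsState u → ∀ x ∈ 𝒮.P,
      ∫⁻ s in Ioc (0 : ℝ) 1, mulLogPos (𝒮.ext u (p + s • (x - p))) ≤ D * (1 + 𝒮.ext u x) := by
    intro u hu x hx
    rcases eq_or_ne (𝒮.ext u x) ∞ with h | h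
    · rw [h, add_top, ENNReal.mul_top (by simpa [hD] using hD0)]
      exact le_top
    -- Adding one gives `V ≥ 1`, as the one-dimensional estimate requires, and costs only the finite
    -- total mass of `σ`.
    set V : ℝ := 1 + (𝒮.ext u x).toReal with hV
    have hV1 : 1 ≤ V := le_add_of_nonneg_right ENNReal.toReal_nonneg
    have hVx : ENNReal.ofReal V = 1 + 𝒮.ext u x := by
      rw [hV, ENNReal.ofReal_add zero_le_one ENNReal.toReal_nonneg, ENNReal.ofReal_toReal h,
        ENNReal.ofReal_one]
    rw [← hVx]
    refine le_trans (setLIntegral_mono' measurableSet_Ioc fun s hs => ?_)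
      (mulLogPos_lintegral_rpow_le hA1 hV1)
    refine mulLogPos_mono ?_
    have h1 := hu.logConvexOn_ext p (interior_subset hp) x hx s hs.1.le hs.2
    have e : (1 - s) • p + s • x = p + s • (x - p) := by module
    rw [e] at h1
    refine h1.trans ?_
    rw [ENNReal.ofReal_mul (by linarith), ← ENNReal.ofReal_rpow_of_pos (by linarith)]
    gcongr
    · calc 𝒮.ext u p ^ (1 - s) ≤ ENNReal.ofReal A ^ (1 - s) :=
            ENNReal.rpow_le_rpow (hAu u hu) (by linarith [hs.2])
        _ ≤ ENNReal.ofReal A ^ (1 : ℝ) :=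
            ENNReal.rpow_le_rpow_of_exponent_le (by simpa using hA1) (by linarith [hs.1])
        _ = ENNReal.ofReal A := ENNReal.rpow_one _
    · exact hs.1.le
    · rw [hVx]; exact le_add_self
  refine ⟨C * (mulLogPos (ENNReal.ofReal A) + D * (𝒮.σ univ + 1)), ?_, fun u hu => ?_⟩
  · refine ENNReal.mul_ne_top hC (ENNReal.add_ne_top.2 ⟨?_, ENNReal.mul_ne_top
      ENNReal.ofReal_ne_top (ENNReal.add_ne_top.2 ⟨𝒮.σ_univ_ne_top, ENNReal.one_ne_top⟩)⟩)
    rw [mulLogPos_ofReal (by linarith)]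
    exact ENNReal.ofReal_ne_top
  have h1 : ∫⁻ x, mulLogPos (u x) ∂𝒮.bulk = ∫⁻ x, mulLogPos (𝒮.ext u x) ∂𝒮.μ := by
    rw [← lintegral_bulk]; simp
  have h2 : ∫⁻ x, u x ∂𝒮.bdry = ∫⁻ x, 𝒮.ext u x ∂𝒮.σ := by
    rw [← lintegral_bdry]; simp
  have hm := measurable_ext hu.measurable
  rw [h1, h2]
  refine (hCg _ (mulLogPos_mono.measurable.comp hm)).trans ?_
  rw [mul_assoc]
  refine mul_le_mul_right ?_ C
  have h3 : ∫⁻ x, (∫⁻ s in Ioc (0 : ℝ) 1, mulLogPos (𝒮.ext u (p + s • (x - p)))) ∂𝒮.σ ≤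
      D * (𝒮.σ univ + ∫⁻ x, 𝒮.ext u x ∂𝒮.σ) := by
    calc _ ≤ ∫⁻ x, D * (1 + 𝒮.ext u x) ∂𝒮.σ := by
          refine lintegral_mono_ae ?_
          filter_upwards [𝒮.ae_mem_P_σ] with x hx using hline u hu x hx
      _ = _ := by
          rw [lintegral_const_mul _ (by fun_prop), lintegral_add_left measurable_const,
            lintegral_const, one_mul]
  set I := ∫⁻ x, 𝒮.ext u x ∂𝒮.σ
  calc mulLogPos (𝒮.ext u p) +
        ∫⁻ x, (∫⁻ s in Ioc (0 : ℝ) 1, mulLogPos (𝒮.ext u (p + s • (x - p)))) ∂𝒮.σ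
      ≤ mulLogPos (ENNReal.ofReal A) + D * (𝒮.σ univ + I) :=
        add_le_add (mulLogPos_mono (hAu u hu)) h3
    _ ≤ mulLogPos (ENNReal.ofReal A) * (1 + I) + D * ((𝒮.σ univ + 1) * (1 + I)) := by
      gcongr
      · exact le_mul_of_one_le_right zero_le le_self_add
      · rw [mul_add, mul_one, add_mul, one_mul]
        exact add_le_add le_self_add le_add_self
    _ = _ := by ring

end System
end MuEntropy

/-! ### Finite energy states and strong convexity of `∫ u log u dμ`. -/

namespace MuEntropy

/-- For `x > 0`, apply `log r ≤ r - 1` to `r = √y / √x`: then `x log (x / y) = -2 x log r ≥ 2 x - 2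
√x √y`, which is the left-hand side. -/
theorem sub_add_sq_sqrt_sub_sqrt_le {x y : ℝ} (hx : 0 ≤ x) (hy : 0 < y) :
    x - y + (√x - √y) ^ 2 ≤ x * Real.log x - x * Real.log y := by
  rcases hx.eq_or_lt with rfl | hx
  · simp [Real.sq_sqrt hy.le]
  have ha : 0 < √x := Real.sqrt_pos.2 hx
  have hb : 0 < √y := Real.sqrt_pos.2 hy
  have hxa : x = √x ^ 2 := (Real.sq_sqrt hx.le).symm
  have hyb : y = √y ^ 2 := (Real.sq_sqrt hy.le).symm
  set a := √x
  set b := √y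
  have h1 := Real.log_le_sub_one_of_pos (div_pos hb ha)
  rw [Real.log_div hb.ne' ha.ne'] at h1
  have h2 : a ^ 2 * (b / a - 1) = a * b - a ^ 2 := by field_simp
  have h3 := mul_le_mul_of_nonneg_left h1 (sq_nonneg a)
  rw [h2] at h3
  rw [hxa, hyb, Real.log_pow, Real.log_pow]
  push_cast
  nlinarith

/-- Compare `a` and `b` with their mean `m` and add: the linear terms cancel, and `(√a - √m)² + (√b
- √m)² ≥ (√a - √b)² / 2`. -/
theorem mul_log_midpoint_le {a b : ℝ} (ha : 0 ≤ a) (hb : 0 ≤ b) :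
    ((a + b) / 2) * Real.log ((a + b) / 2) + (√a - √b) ^ 2 / 4 ≤
      (a * Real.log a + b * Real.log b) / 2 := by
  rcases (add_nonneg ha hb).eq_or_lt with h | h
  · have ha' : a = 0 := by linarith
    have hb' : b = 0 := by linarith
    simp [ha', hb']
  have hm : 0 < (a + b) / 2 := by linarith
  have h1 := sub_add_sq_sqrt_sub_sqrt_le ha hm
  have h2 := sub_add_sq_sqrt_sub_sqrt_le hb hm
  set m := (a + b) / 2 with hmdef
  have h3 : a * Real.log m + b * Real.log m = 2 * (m * Real.log m) := by rw [hmdef]; ring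
  have h4 : a + b = 2 * m := by rw [hmdef]; ring
  nlinarith [sq_nonneg (√a + √b - 2 * √m)]

/-- Because `-a log a ≤ 1 - a`. The negative part is therefore always integrable, and only the
positive part needs the energy. -/
theorem mulLogNeg_le_one (a : ℝ≥0∞) : mulLogNeg a ≤ 1 := by
  rcases eq_or_ne a ∞ with rfl | ha
  · have : -(((∞ : ℝ≥0∞) : EReal) * ENNReal.log ∞) ≤ 0 := by simp
    rw [mulLogNeg, EReal.toENNReal_of_nonpos this]
    exact zero_le
  · rw [← ENNReal.ofReal_toReal ha, mulLogNeg_ofReal ENNReal.toReal_nonneg]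
    refine ENNReal.ofReal_le_one.2 ?_
    have h1 := sub_add_sq_sqrt_sub_sqrt_le (ENNReal.toReal_nonneg (a := a)) one_pos
    rw [Real.log_one, mul_zero, sub_zero] at h1
    nlinarith [sq_nonneg (√a.toReal - √1), ENNReal.toReal_nonneg (a := a)]

namespace System

variable {E : Type*} [NormedAddCommGroup E] [NormedSpace ℝ E] [MeasurableSpace E] (𝒮 : System E)

/-- States of finite energy. -/
def IsFiniteState (u : 𝒮.P → ℝ≥0∞) : Prop := 𝒮.IsState u ∧ 𝒮.energy u ≠ ∞

/-- The real number `∫ u log u dμ`. -/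
noncomputable def relEntropy (u : 𝒮.P → ℝ≥0∞) : ℝ :=
  ∫ x, (u x).toReal * Real.log (u x).toReal ∂𝒮.bulk

/-- The linear interpolation of two functions. -/
noncomputable def mix (t : ℝ) (u v : 𝒮.P → ℝ≥0∞) : 𝒮.P → ℝ≥0∞ := fun x =>
  ENNReal.ofReal (1 - t) * u x + ENNReal.ofReal t * v x

variable {𝒮} [BorelSpace E] [FiniteDimensional ℝ E] {u v : 𝒮.P → ℝ≥0∞}

theorem IsState.lintegral_ne_top (hu : 𝒮.IsState u) : ∫⁻ x, u x ∂𝒮.bulk ≠ ∞ := by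
  rw [hu.normalized]; exact μ_P_ne_top

theorem IsState.ae_ne_top (hu : 𝒮.IsState u) : ∀ᵐ x ∂𝒮.bulk, u x ≠ ∞ :=
  (ae_lt_top hu.measurable hu.lintegral_ne_top).mono fun _ h => h.ne

theorem IsState.integrable_toReal (hu : 𝒮.IsState u) :
    Integrable (fun x => (u x).toReal) 𝒮.bulk :=
  integrable_toReal_of_lintegral_ne_top hu.measurable.aemeasurable hu.lintegral_ne_top

theorem IsState.integral_toReal (hu : 𝒮.IsState u) :
    ∫ x, (u x).toReal ∂𝒮.bulk = (𝒮.μ 𝒮.P).toReal := by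
  rw [MeasureTheory.integral_toReal hu.measurable.aemeasurable
    (ae_lt_top hu.measurable hu.lintegral_ne_top), hu.normalized]

theorem lintegral_bdry_eq (u : 𝒮.P → ℝ≥0∞) :
    ∫⁻ x, u x ∂𝒮.bdry = 𝒮.energy u * 𝒮.μ 𝒮.P := by
  rw [energy, ENNReal.div_mul_cancel μ_P_ne_zero μ_P_ne_top]

theorem IsFiniteState.lintegral_mulLogPos_ne_top (hu : 𝒮.IsFiniteState u) :
    ∫⁻ x, mulLogPos (u x) ∂𝒮.bulk ≠ ∞ := by
  obtain ⟨K, hK, h⟩ := 𝒮.exists_lintegral_mulLogPos_le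
  refine ne_top_of_le_ne_top ?_ (h u hu.1)
  rw [lintegral_bdry_eq]
  exact ENNReal.mul_ne_top hK (ENNReal.add_ne_top.2 ⟨ENNReal.one_ne_top,
    ENNReal.mul_ne_top hu.2 μ_P_ne_top⟩)

theorem lintegral_mulLogNeg_ne_top (u : 𝒮.P → ℝ≥0∞) :
    ∫⁻ x, mulLogNeg (u x) ∂𝒮.bulk ≠ ∞ := by
  refine ne_top_of_le_ne_top ?_ (lintegral_mono fun x => mulLogNeg_le_one (u x))
  rw [lintegral_one]
  exact measure_ne_top _ _

theorem IsState.lintegral_ofReal_mul_log (hu : 𝒮.IsState u) :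
    ∫⁻ x, ENNReal.ofReal ((u x).toReal * Real.log (u x).toReal) ∂𝒮.bulk =
      ∫⁻ x, mulLogPos (u x) ∂𝒮.bulk := by
  refine lintegral_congr_ae ?_
  filter_upwards [hu.ae_ne_top] with x hx
  rw [← mulLogPos_ofReal ENNReal.toReal_nonneg, ENNReal.ofReal_toReal hx]

theorem IsState.lintegral_ofReal_neg_mul_log (hu : 𝒮.IsState u) :
    ∫⁻ x, ENNReal.ofReal (-((u x).toReal * Real.log (u x).toReal)) ∂𝒮.bulk =
      ∫⁻ x, mulLogNeg (u x) ∂𝒮.bulk := by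
  refine lintegral_congr_ae ?_
  filter_upwards [hu.ae_ne_top] with x hx
  rw [← mulLogNeg_ofReal ENNReal.toReal_nonneg, ENNReal.ofReal_toReal hx]

theorem IsFiniteState.integrable_mul_log (hu : 𝒮.IsFiniteState u) :
    Integrable (fun x => (u x).toReal * Real.log (u x).toReal) 𝒮.bulk := by
  have hm : Measurable fun x => (u x).toReal * Real.log (u x).toReal := by
    have := hu.1.measurable.ennreal_toReal
    exact this.mul (Real.measurable_log.comp this)
  refine ⟨hm.aestronglyMeasurable, ?_⟩
  rw [hasFiniteIntegral_iff_norm]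
  have hle : ∀ r : ℝ, ENNReal.ofReal ‖r‖ ≤ ENNReal.ofReal r + ENNReal.ofReal (-r) := by
    intro r
    rcases le_total 0 r with h | h
    · rw [Real.norm_of_nonneg h]; exact le_self_add
    · rw [Real.norm_of_nonpos h]; exact le_add_self
  refine (lintegral_mono fun x => hle _).trans_lt ?_
  rw [lintegral_add_left hm.ennreal_ofReal, hu.1.lintegral_ofReal_mul_log,
    hu.1.lintegral_ofReal_neg_mul_log]
  exact ENNReal.add_lt_top.2 ⟨hu.lintegral_mulLogPos_ne_top.lt_top,
    (lintegral_mulLogNeg_ne_top u).lt_top⟩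

theorem IsFiniteState.relEntropy_eq (hu : 𝒮.IsFiniteState u) :
    𝒮.relEntropy u = (∫⁻ x, mulLogPos (u x) ∂𝒮.bulk).toReal -
      (∫⁻ x, mulLogNeg (u x) ∂𝒮.bulk).toReal := by
  rw [relEntropy, integral_eq_lintegral_pos_part_sub_lintegral_neg_part hu.integrable_mul_log,
    hu.1.lintegral_ofReal_mul_log, hu.1.lintegral_ofReal_neg_mul_log]

variable (𝒮) in
/-- The total mass of `μ`, as a real number. -/
noncomputable def mass : ℝ := (𝒮.μ 𝒮.P).toReal

theorem mass_pos : 0 < 𝒮.mass := ENNReal.toReal_pos μ_P_ne_zero μ_P_ne_top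

theorem IsFiniteState.entropy_eq (hu : 𝒮.IsFiniteState u) :
    𝒮.entropy u = ((-(𝒮.relEntropy u / 𝒮.mass) : ℝ) : EReal) := by
  have h1 : eintegral 𝒮.bulk (fun x => (u x : EReal) * ENNReal.log (u x)) =
      ((𝒮.relEntropy u : ℝ) : EReal) := by
    rw [hu.relEntropy_eq, EReal.coe_sub, EReal.coe_ennreal_toReal hu.lintegral_mulLogPos_ne_top,
      EReal.coe_ennreal_toReal (lintegral_mulLogNeg_ne_top u)]
    rfl
  have h2 : ((𝒮.μ 𝒮.P : ℝ≥0∞) : EReal) = ((𝒮.mass : ℝ) : EReal) := by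
    rw [mass, EReal.coe_ennreal_toReal μ_P_ne_top]
  rw [entropy, h1, h2, ← EReal.coe_div, ← EReal.coe_neg]

theorem IsFiniteState.entropy_le_iff (hu : 𝒮.IsFiniteState u) (hv : 𝒮.IsFiniteState v) :
    𝒮.entropy v ≤ 𝒮.entropy u ↔ 𝒮.relEntropy u ≤ 𝒮.relEntropy v := by
  rw [hu.entropy_eq, hv.entropy_eq, EReal.coe_le_coe_iff, neg_le_neg_iff,
    div_le_div_iff_of_pos_right mass_pos]

theorem IsFiniteState.entropy_ne_bot (hu : 𝒮.IsFiniteState u) : 𝒮.entropy u ≠ ⊥ := by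
  rw [hu.entropy_eq]; exact EReal.coe_ne_bot _

variable (𝒮) in
theorem exists_relEntropy_le : ∃ K : ℝ, 0 ≤ K ∧ ∀ u, 𝒮.IsFiniteState u →
    𝒮.relEntropy u ≤ K * (1 + (𝒮.energy u).toReal) := by
  obtain ⟨K, hK, h⟩ := 𝒮.exists_lintegral_mulLogPos_le
  refine ⟨K.toReal * (1 + 𝒮.mass), by have := 𝒮.mass_pos; positivity, fun u hu => ?_⟩
  have h1 := h u hu.1
  rw [lintegral_bdry_eq] at h1
  have h2 : K * (1 + 𝒮.energy u * 𝒮.μ 𝒮.P) ≠ ∞ :=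
    ENNReal.mul_ne_top hK (ENNReal.add_ne_top.2 ⟨ENNReal.one_ne_top,
      ENNReal.mul_ne_top hu.2 μ_P_ne_top⟩)
  have h3 := ENNReal.toReal_mono h2 h1
  rw [ENNReal.toReal_mul, ENNReal.toReal_add ENNReal.one_ne_top
    (ENNReal.mul_ne_top hu.2 μ_P_ne_top), ENNReal.toReal_mul, ENNReal.toReal_one] at h3
  have h4 := hu.relEntropy_eq
  have h5 : 0 ≤ (∫⁻ x, mulLogNeg (u x) ∂𝒮.bulk).toReal := ENNReal.toReal_nonneg
  have h6 : 0 ≤ (𝒮.energy u).toReal := ENNReal.toReal_nonneg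
  have h7 : 0 ≤ K.toReal := ENNReal.toReal_nonneg
  have h8 := 𝒮.mass_pos
  have h9 : 1 + (𝒮.energy u).toReal * 𝒮.mass ≤ (1 + 𝒮.mass) * (1 + (𝒮.energy u).toReal) := by
    nlinarith
  have h10 := mul_le_mul_of_nonneg_left h9 h7
  change _ ≤ K.toReal * (1 + (𝒮.energy u).toReal * 𝒮.mass) at h3
  linarith

theorem isState_one : 𝒮.IsState 𝒮.one where
  pos _ := one_pos
  lsc := lowerSemicontinuous_const
  logConvex _ _ _ t _ _ _ := by simp [one]
  normalized := by simp [one, bulk_univ]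

theorem isFiniteState_one : 𝒮.IsFiniteState 𝒮.one := by
  refine ⟨isState_one, ?_⟩
  simp only [energy, one, lintegral_one]
  exact ENNReal.div_ne_top (measure_ne_top _ _) μ_P_ne_zero

theorem relEntropy_one : 𝒮.relEntropy 𝒮.one = 0 := by simp [relEntropy, one]

/-- Integrate `r log r ≥ r - 1`; the right side has integral zero by normalization. -/
theorem IsFiniteState.relEntropy_nonneg (hu : 𝒮.IsFiniteState u) : 0 ≤ 𝒮.relEntropy u := by
  have h : ∫ x, ((u x).toReal - 1) ∂𝒮.bulk ≤ 𝒮.relEntropy u := by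
    refine integral_mono (hu.1.integrable_toReal.sub (integrable_const 1)) hu.integrable_mul_log
      fun x => ?_
    have h1 := sub_add_sq_sqrt_sub_sqrt_le (ENNReal.toReal_nonneg (a := u x)) one_pos
    rw [Real.log_one, mul_zero, sub_zero] at h1
    have := sq_nonneg (√(u x).toReal - √1)
    change (u x).toReal - 1 ≤ (u x).toReal * Real.log (u x).toReal
    linarith
  rw [integral_sub hu.1.integrable_toReal (integrable_const 1), hu.1.integral_toReal,
    integral_const, measureReal_def, bulk_univ] at h
  simpa using h

section Mix

variable {t : ℝ}

theorem energy_mix (hv : Measurable v) (hu : Measurable u) :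
    𝒮.energy (𝒮.mix t u v) =
      ENNReal.ofReal (1 - t) * 𝒮.energy u + ENNReal.ofReal t * 𝒮.energy v := by
  simp only [energy, mix]
  rw [lintegral_add_left (hu.const_mul _), lintegral_const_mul _ hu, lintegral_const_mul _ hv,
    ENNReal.add_div, mul_div_assoc, mul_div_assoc]

theorem const_mul_rpow_mul_rpow {c : ℝ≥0∞} (hc : c ≠ 0) (hc' : c ≠ ∞) (a b : ℝ≥0∞) {s : ℝ}
    (hs0 : 0 ≤ s) (hs1 : s ≤ 1) :
    (c * a) ^ (1 - s) * (c * b) ^ s = c * (a ^ (1 - s) * b ^ s) := by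
  rw [ENNReal.mul_rpow_of_nonneg _ _ (by linarith), ENNReal.mul_rpow_of_nonneg _ _ hs0]
  have : c ^ (1 - s) * c ^ s = c := by
    rw [← ENNReal.rpow_add _ _ hc hc', sub_add_cancel, ENNReal.rpow_one]
  calc c ^ (1 - s) * a ^ (1 - s) * (c ^ s * b ^ s)
      = (c ^ (1 - s) * c ^ s) * (a ^ (1 - s) * b ^ s) := by ring
    _ = _ := by rw [this]

/-- A weight `c` can be written `c ^ (1 - s) * c ^ s` and absorbed into the powers, after which
Hölder's inequality handles the sum. -/
theorem IsState.mix (hu : 𝒮.IsState u) (hv : 𝒮.IsState v) (ht0 : 0 < t) (ht1 : t < 1) :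
    𝒮.IsState (𝒮.mix t u v) := by
  have h1 : ENNReal.ofReal (1 - t) ≠ 0 := by simpa using ht1
  have h2 : ENNReal.ofReal t ≠ 0 := by simpa using ht0
  refine ⟨fun x => ?_, ?_, fun x y z s hs0 hs1 hz => ?_, ?_⟩
  · exact (ENNReal.mul_pos h1 (hu.pos x).ne').trans_le le_self_add
  · have hc : ∀ c : ℝ≥0∞, c ≠ ∞ → ∀ w : 𝒮.P → ℝ≥0∞, LowerSemicontinuous w →
        LowerSemicontinuous fun x => c * w x := fun c hc w hw =>
      (ENNReal.continuous_const_mul hc).comp_lowerSemicontinuous hw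
        fun a b hab => mul_le_mul_right hab c
    exact (hc _ ENNReal.ofReal_ne_top u hu.lsc).add (hc _ ENNReal.ofReal_ne_top v hv.lsc)
  · calc ENNReal.ofReal (1 - t) * u z + ENNReal.ofReal t * v z
        ≤ ENNReal.ofReal (1 - t) * (u x ^ (1 - s) * u y ^ s) +
            ENNReal.ofReal t * (v x ^ (1 - s) * v y ^ s) := by
          gcongr
          · exact hu.logConvex x y z s hs0 hs1 hz
          · exact hv.logConvex x y z s hs0 hs1 hz
      _ ≤ _ := by
          rw [← const_mul_rpow_mul_rpow h1 ENNReal.ofReal_ne_top _ _ hs0 hs1,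
            ← const_mul_rpow_mul_rpow h2 ENNReal.ofReal_ne_top _ _ hs0 hs1]
          exact ennreal_add_rpow_mul_rpow_le hs0 hs1 _ _ _ _
  · simp only [System.mix]
    rw [lintegral_add_left (hu.measurable.const_mul _), lintegral_const_mul _ hu.measurable,
      lintegral_const_mul _ hv.measurable, hu.normalized, hv.normalized, ← add_mul,
      ← ENNReal.ofReal_add (by linarith) ht0.le]
    simp

theorem IsFiniteState.mix (hu : 𝒮.IsFiniteState u) (hv : 𝒮.IsFiniteState v) (ht0 : 0 < t)
    (ht1 : t < 1) : 𝒮.IsFiniteState (𝒮.mix t u v) := by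
  refine ⟨hu.1.mix hv.1 ht0 ht1, ?_⟩
  rw [energy_mix hv.1.measurable hu.1.measurable]
  exact ENNReal.add_ne_top.2 ⟨ENNReal.mul_ne_top ENNReal.ofReal_ne_top hu.2,
    ENNReal.mul_ne_top ENNReal.ofReal_ne_top hv.2⟩

theorem IsFiniteState.toReal_energy_mix (hu : 𝒮.IsFiniteState u) (hv : 𝒮.IsFiniteState v)
    (ht0 : 0 < t) (ht1 : t < 1) : (𝒮.energy (𝒮.mix t u v)).toReal =
      (1 - t) * (𝒮.energy u).toReal + t * (𝒮.energy v).toReal := by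
  rw [energy_mix hv.1.measurable hu.1.measurable, ENNReal.toReal_add
    (ENNReal.mul_ne_top ENNReal.ofReal_ne_top hu.2) (ENNReal.mul_ne_top ENNReal.ofReal_ne_top hv.2),
    ENNReal.toReal_mul, ENNReal.toReal_mul, ENNReal.toReal_ofReal (by linarith),
    ENNReal.toReal_ofReal ht0.le]

theorem IsState.toReal_mix_ae (hu : 𝒮.IsState u) (hv : 𝒮.IsState v) (ht0 : 0 < t) (ht1 : t < 1) :
    ∀ᵐ x ∂𝒮.bulk, (𝒮.mix t u v x).toReal = (1 - t) * (u x).toReal + t * (v x).toReal := by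
  filter_upwards [hu.ae_ne_top, hv.ae_ne_top] with x hx hx'
  rw [System.mix, ENNReal.toReal_add (ENNReal.mul_ne_top ENNReal.ofReal_ne_top hx)
    (ENNReal.mul_ne_top ENNReal.ofReal_ne_top hx'), ENNReal.toReal_mul, ENNReal.toReal_mul,
    ENNReal.toReal_ofReal (by linarith), ENNReal.toReal_ofReal ht0.le]

theorem IsFiniteState.relEntropy_mix_le (hu : 𝒮.IsFiniteState u) (hv : 𝒮.IsFiniteState v)
    (ht0 : 0 < t) (ht1 : t < 1) : 𝒮.relEntropy (𝒮.mix t u v) ≤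
      (1 - t) * 𝒮.relEntropy u + t * 𝒮.relEntropy v := by
  simp only [relEntropy]
  rw [← integral_const_mul, ← integral_const_mul, ← integral_add
    (hu.integrable_mul_log.const_mul _) (hv.integrable_mul_log.const_mul _)]
  refine integral_mono_ae (hu.mix hv ht0 ht1).integrable_mul_log
    ((hu.integrable_mul_log.const_mul _).add (hv.integrable_mul_log.const_mul _)) ?_
  filter_upwards [hu.1.toReal_mix_ae hv.1 ht0 ht1] with x hx
  rw [hx]
  have := Real.convexOn_mul_log.2 (ENNReal.toReal_nonneg (a := u x))
    (ENNReal.toReal_nonneg (a := v x)) (sub_pos.2 ht1).le ht0.le (by ring)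
  simpa using this

theorem IsState.integrable_sq_sqrt_sub_sqrt (hu : 𝒮.IsState u) (hv : 𝒮.IsState v) :
    Integrable (fun x => (√(u x).toReal - √(v x).toReal) ^ 2) 𝒮.bulk := by
  have hm : Measurable fun x => (√(u x).toReal - √(v x).toReal) ^ 2 :=
    (hu.measurable.ennreal_toReal.sqrt.sub hv.measurable.ennreal_toReal.sqrt).pow_const 2
  refine (hu.integrable_toReal.add hv.integrable_toReal).mono' hm.aestronglyMeasurable
    (Eventually.of_forall fun x => ?_)
  have h1 := Real.sq_sqrt (ENNReal.toReal_nonneg (a := u x))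
  have h2 := Real.sq_sqrt (ENNReal.toReal_nonneg (a := v x))
  have h3 := Real.sqrt_nonneg (u x).toReal
  have h4 := Real.sqrt_nonneg (v x).toReal
  rw [Real.norm_of_nonneg (sq_nonneg _)]
  change _ ≤ (u x).toReal + (v x).toReal
  nlinarith

/-- Strong convexity of `∫ u log u dμ`. -/
theorem IsFiniteState.relEntropy_midpoint_le (hu : 𝒮.IsFiniteState u) (hv : 𝒮.IsFiniteState v) :
    𝒮.relEntropy (𝒮.mix (1 / 2) u v) + (∫ x, (√(u x).toReal - √(v x).toReal) ^ 2 ∂𝒮.bulk) / 4 ≤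
      (𝒮.relEntropy u + 𝒮.relEntropy v) / 2 := by
  have hi := hu.1.integrable_sq_sqrt_sub_sqrt hv.1
  have hmix := (hu.mix hv (t := 1 / 2) (by norm_num) (by norm_num)).integrable_mul_log
  simp only [relEntropy]
  rw [← integral_div, ← integral_add hmix (hi.div_const 4),
    ← integral_add hu.integrable_mul_log hv.integrable_mul_log, ← integral_div]
  refine integral_mono_ae (hmix.add (hi.div_const 4))
    ((hu.integrable_mul_log.add hv.integrable_mul_log).div_const 2) ?_
  filter_upwards [hu.1.toReal_mix_ae hv.1 (t := 1 / 2) (by norm_num) (by norm_num)] with x hx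
  have e : (1 - 1 / 2) * (u x).toReal + 1 / 2 * (v x).toReal =
      ((u x).toReal + (v x).toReal) / 2 := by ring
  rw [hx, e]
  exact mul_log_midpoint_le ENNReal.toReal_nonneg ENNReal.toReal_nonneg

/-- Without a strict drop at the midpoint the quadratic gain vanishes, so the states agree almost
everywhere, hence everywhere. Every uniqueness claim comes down to this. -/
theorem IsFiniteState.eq_of_le_relEntropy_midpoint (hu : 𝒮.IsFiniteState u)
    (hv : 𝒮.IsFiniteState v)
    (h : (𝒮.relEntropy u + 𝒮.relEntropy v) / 2 ≤ 𝒮.relEntropy (𝒮.mix (1 / 2) u v)) : u = v := by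
  have h1 := hu.relEntropy_midpoint_le hv
  have h2 : ∫ x, (√(u x).toReal - √(v x).toReal) ^ 2 ∂𝒮.bulk = 0 :=
    le_antisymm (by linarith) (integral_nonneg fun x => sq_nonneg _)
  rw [integral_eq_zero_iff_of_nonneg (fun x => sq_nonneg _)
    (hu.1.integrable_sq_sqrt_sub_sqrt hv.1)] at h2
  refine hu.1.eq_of_ae_eq hv.1 ?_
  filter_upwards [h2, hu.1.ae_ne_top, hv.1.ae_ne_top] with x hx hux hvx
  have h3 : √(u x).toReal = √(v x).toReal := by
    have : (√(u x).toReal - √(v x).toReal) ^ 2 = 0 := hx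
    exact sub_eq_zero.1 (pow_eq_zero_iff two_ne_zero |>.1 this)
  rw [Real.sqrt_inj ENNReal.toReal_nonneg ENNReal.toReal_nonneg] at h3
  exact (ENNReal.toReal_eq_toReal_iff' hux hvx).1 h3

end Mix

end System
end MuEntropy

/-! ### Convergence of states almost everywhere and in the interior. -/

namespace MuEntropy
namespace System

variable {E : Type*} [NormedAddCommGroup E] [NormedSpace ℝ E] [MeasurableSpace E] {𝒮 : System E}
  [BorelSpace E] [FiniteDimensional ℝ E]

theorem ae_bulk_iff {q : E → Prop} : (∀ᵐ x : 𝒮.P ∂𝒮.bulk, q x) ↔ ∀ᵐ x ∂𝒮.μ, q x := by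
  rw [← (MeasurableEmbedding.subtype_coe 𝒮.measurableSet_P).ae_map_iff, bulk,
    map_comap_subtype_coe 𝒮.measurableSet_P, Measure.restrict_eq_self_of_ae_mem ae_mem_P_μ]

theorem ae_mem_interior : ∀ᵐ x ∂𝒮.μ, x ∈ interior 𝒮.P := by
  obtain ⟨ν, hν, hμ⟩ := 𝒮.flat_μ
  have h1 : ∀ᵐ x ∂ν, x ∉ frontier 𝒮.P :=
    measure_eq_zero_iff_ae_notMem.1 (𝒮.convex_P.addHaar_frontier ν)
  have h2 : ∀ᵐ x ∂𝒮.μ, x ∉ frontier 𝒮.P := by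
    rw [hμ]; exact ae_restrict_of_ae h1
  filter_upwards [h2, 𝒮.ae_mem_P_μ] with x hx hxP
  by_contra h
  exact hx ⟨subset_closure hxP, h⟩

theorem IsState.memLp_sqrt {u : 𝒮.P → ℝ≥0∞} (hu : 𝒮.IsState u) :
    MemLp (fun x => √(u x).toReal) 2 𝒮.bulk := by
  rw [memLp_two_iff_integrable_sq hu.measurable.ennreal_toReal.sqrt.aestronglyMeasurable]
  simpa [Real.sq_sqrt ENNReal.toReal_nonneg] using hu.integrable_toReal

/-- A sequence of states whose square roots are Cauchy in `L²` has a subsequence which converges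
almost everywhere, to a function with the same integral. -/
theorem exists_subseq_tendsto_ae {u : ℕ → 𝒮.P → ℝ≥0∞} (hu : ∀ n, 𝒮.IsState (u n))
    (hcau : ∀ ε > 0, ∃ N, ∀ m ≥ N, ∀ n ≥ N,
      ∫ x, (√(u m x).toReal - √(u n x).toReal) ^ 2 ∂𝒮.bulk ≤ ε) :
    ∃ (φ : ℕ → ℕ) (g : 𝒮.P → ℝ≥0∞), StrictMono φ ∧ ∫⁻ x, g x ∂𝒮.bulk = 𝒮.μ 𝒮.P ∧
      (∀ x, g x ≠ ∞) ∧
      ∀ᵐ x ∂𝒮.bulk, Tendsto (fun n => u (φ n) x) atTop (𝓝 (g x)) := by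
  let F : ℕ → Lp ℝ 2 𝒮.bulk := fun n => (hu n).memLp_sqrt.toLp
  have hsq : ∀ f : Lp ℝ 2 𝒮.bulk, ‖f‖ ^ 2 = ∫ x, f x ^ 2 ∂𝒮.bulk := by
    intro f
    have := L2.inner_def (𝕜 := ℝ) f f
    rw [real_inner_self_eq_norm_sq] at this
    rw [this]
    refine integral_congr_ae (Eventually.of_forall fun x => ?_)
    simp
  have hdist : ∀ m n, dist (F m) (F n) ^ 2 =
      ∫ x, (√(u m x).toReal - √(u n x).toReal) ^ 2 ∂𝒮.bulk := by
    intro m n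
    rw [dist_eq_norm, hsq]
    refine integral_congr_ae ?_
    filter_upwards [Lp.coeFn_sub (F m) (F n), (hu m).memLp_sqrt.coeFn_toLp,
      (hu n).memLp_sqrt.coeFn_toLp] with x h1 h2 h3
    simp only [F] at h1 ⊢
    rw [h1, Pi.sub_apply, h2, h3]
  have hC : CauchySeq F := by
    rw [Metric.cauchySeq_iff]
    intro ε hε
    obtain ⟨N, hN⟩ := hcau ((ε / 2) ^ 2) (by positivity)
    refine ⟨N, fun m hm n hn => ?_⟩
    have h1 := hN m hm n hn
    rw [← hdist] at h1
    have h2 := (sq_le_sq₀ dist_nonneg (by positivity)).1 h1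
    linarith
  obtain ⟨G, hG⟩ := cauchySeq_tendsto_of_complete hC
  -- Each `√(u n)` has squared norm equal to the mass, and strong convergence preserves it.
  have hnorm : ‖G‖ ^ 2 = 𝒮.mass := by
    have h1 : Tendsto (fun n => ‖F n‖ ^ 2) atTop (𝓝 (‖G‖ ^ 2)) := (hG.norm).pow 2
    have h2 : ∀ n, ‖F n‖ ^ 2 = 𝒮.mass := by
      intro n
      rw [hsq, mass, ← (hu n).integral_toReal]
      refine integral_congr_ae ?_
      filter_upwards [(hu n).memLp_sqrt.coeFn_toLp] with x h
      simp only [F]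
      rw [h, Real.sq_sqrt ENNReal.toReal_nonneg]
    simp_rw [h2] at h1
    exact tendsto_nhds_unique h1 tendsto_const_nhds
  obtain ⟨φ, hφ, hae⟩ := (tendstoInMeasure_of_tendsto_Lp hG).exists_seq_tendsto_ae
  refine ⟨φ, fun x => ENNReal.ofReal (G x ^ 2), hφ, ?_, fun x => ENNReal.ofReal_ne_top, ?_⟩
  · rw [← ofReal_integral_eq_lintegral_ofReal (Lp.memLp G).integrable_sq
      (Eventually.of_forall fun x => sq_nonneg _), ← hsq, hnorm, mass,
      ENNReal.ofReal_toReal μ_P_ne_top]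
  · have hall : ∀ᵐ x ∂𝒮.bulk, ∀ n, F n x = √(u n x).toReal ∧ u n x ≠ ∞ :=
      ae_all_iff.2 fun n => ((hu n).memLp_sqrt.coeFn_toLp).and (hu n).ae_ne_top
    filter_upwards [hae, hall] with x hx hx'
    have h1 := (ENNReal.continuous_ofReal.tendsto _).comp (hx.pow 2)
    refine h1.congr fun n => ?_
    simp only [Function.comp]
    rw [(hx' _).1, Real.sq_sqrt ENNReal.toReal_nonneg, ENNReal.ofReal_toReal (hx' _).2]

/-- States which converge almost everywhere converge in the interior. -/
theorem exists_tendsto_interior {v : ℕ → 𝒮.P → ℝ≥0∞} (hv : ∀ n, 𝒮.IsState (v n))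
    {g : 𝒮.P → ℝ≥0∞} (hae : ∀ᵐ x ∂𝒮.bulk, Tendsto (fun n => v n x) atTop (𝓝 (g x))) :
    ∃ w : E → ℝ≥0∞, (∀ y ∈ interior 𝒮.P, w y ≠ ∞ ∧
      Tendsto (fun n => 𝒮.ext (v n) y) atTop (𝓝 (w y))) := by
  -- Ultrafilter limits always exist in `[0, ∞]`. In the interior they are finite and convex, and
  -- along any ultrafilter finer than `atTop` they equal `g` almost everywhere; by continuity they
  -- all coincide, which is convergence.
  let W : Ultrafilter ℕ → E → ℝ≥0∞ := fun U y => (U.map fun n => 𝒮.ext (v n) y).lim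
  have hW : ∀ (U : Ultrafilter ℕ) y, Tendsto (fun n => 𝒮.ext (v n) y) (U : Filter ℕ) (𝓝 (W U y)) := fun U y =>
    (U.map fun n => 𝒮.ext (v n) y).le_nhds_lim
  have hfin : ∀ U, ∀ y ∈ interior 𝒮.P, W U y ≠ ∞ := by
    intro U y hy
    obtain ⟨C, hC, h⟩ := exists_forall_isState_le hy
    exact ne_top_of_le_ne_top hC (le_of_tendsto' (hW U y) fun n => h _ (hv n))
  have hconv : ∀ U, EConvexOn (interior 𝒮.P) (W U) := by
    intro U x hx y hy t ht0 ht1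
    refine le_of_tendsto_of_tendsto' (hW U _) ((ENNReal.Tendsto.const_mul (hW U x)
      (Or.inr ENNReal.ofReal_ne_top)).add (ENNReal.Tendsto.const_mul (hW U y)
      (Or.inr ENNReal.ofReal_ne_top))) fun n => ?_
    exact (hv n).logConvexOn_ext.eConvexOn x (interior_subset hx) y (interior_subset hy) t ht0 ht1
  have hlim : ∀ U : Ultrafilter ℕ, (U : Filter ℕ) ≤ atTop →
      ∀ᵐ x : 𝒮.P ∂𝒮.bulk, W U x = g x := by
    intro U hU
    filter_upwards [hae] with x hx
    refine tendsto_nhds_unique (hW U x) ?_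
    simpa using hx.mono_left hU
  have hWeq : ∀ U V : Ultrafilter ℕ, (U : Filter ℕ) ≤ atTop → (V : Filter ℕ) ≤ atTop →
      EqOn (W U) (W V) (interior 𝒮.P) := by
    intro U V hU hV
    refine eqOn_interior_of_ae_eq (hconv U) (hconv V) (hfin U) (hfin V) ?_
    refine ae_bulk_iff.1 ?_
    filter_upwards [hlim U hU, hlim V hV] with x h1 h2
    rw [h1, h2]
  refine ⟨W (hyperfilter ℕ), fun y hy => ⟨hfin _ y hy, ?_⟩⟩
  rw [tendsto_iff_ultrafilter]
  intro U hU
  rw [hWeq _ U Nat.hyperfilter_le_atTop hU hy]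
  exact hW U y

end System
end MuEntropy

/-! ### Extending interior limits to the boundary. -/

namespace MuEntropy
namespace System

variable {E : Type*} [NormedAddCommGroup E] [NormedSpace ℝ E] [MeasurableSpace E] (𝒮 : System E)
  {p : E} {q : E → ℝ}

/-- The exponent of the extrapolation of `exp q` from `p + r (x - p)` to `x`, along the ray
from `p`. -/
noncomputable def rayExponent (q : E → ℝ) (p : E) (r : ℝ) (x : E) : ℝ :=
  (q ((1 - r) • p + r • x) - (1 - r) * q p) / r

/-- The lower semicontinuous log convex extension to `P` of `exp q`, for `q` convex in the
interior of `P`. -/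
noncomputable def envelope (q : E → ℝ) (p : E) : 𝒮.P → ℝ≥0∞ := fun x =>
  ⨆ r : Ioo (0 : ℝ) 1, ENNReal.ofReal (Real.exp (rayExponent q p r x))

variable {𝒮}

theorem combo_mem_interior (hp : p ∈ interior 𝒮.P) (r : Ioo (0 : ℝ) 1) {x : E} (hx : x ∈ 𝒮.P) :
    (1 - (r : ℝ)) • p + (r : ℝ) • x ∈ interior 𝒮.P :=
  𝒮.convex_P.combo_interior_self_mem_interior hp hx (by linarith [r.2.2]) r.2.1.le (by ring)

theorem envelope_pos (x : 𝒮.P) : 0 < 𝒮.envelope q p x := by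
  refine lt_of_lt_of_le ?_ (le_iSup _ (⟨1 / 2, by norm_num, by norm_num⟩ : Ioo (0 : ℝ) 1))
  exact ENNReal.ofReal_pos.2 (Real.exp_pos _)

/-- A supremum of continuous functions: for fixed `r < 1` the point `(1 - r) • p + r • x` stays in
the interior. -/
theorem lowerSemicontinuous_envelope (hp : p ∈ interior 𝒮.P)
    (hq : ContinuousOn q (interior 𝒮.P)) : LowerSemicontinuous (𝒮.envelope q p) := by
  refine lowerSemicontinuous_iSup fun r => Continuous.lowerSemicontinuous ?_
  refine ENNReal.continuous_ofReal.comp (Real.continuous_exp.comp ?_)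
  have h1 : Continuous fun x : 𝒮.P => q ((1 - (r : ℝ)) • p + (r : ℝ) • (x : E)) :=
    hq.comp_continuous (by fun_prop) fun x => combo_mem_interior hp r x.2
  exact (h1.sub continuous_const).div_const _

/-- For fixed `r`, `rayExponent` is convex in `x`, being `q` after an affine map up to a constant
and a positive factor. -/
theorem logConvex_envelope (hp : p ∈ interior 𝒮.P) (hq : ConvexOn ℝ (interior 𝒮.P) q)
    (x y z : 𝒮.P) (t : ℝ) (ht0 : 0 ≤ t) (ht1 : t ≤ 1)
    (hz : (z : E) = (1 - t) • (x : E) + t • (y : E)) :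
    𝒮.envelope q p z ≤ 𝒮.envelope q p x ^ (1 - t) * 𝒮.envelope q p y ^ t := by
  refine iSup_le fun r => ?_
  have hr := r.2.1
  have h1 : rayExponent q p r z ≤ (1 - t) * rayExponent q p r x + t * rayExponent q p r y := by
    have h2 := hq.2 (combo_mem_interior hp r x.2) (combo_mem_interior hp r y.2)
      (sub_nonneg.2 ht1) ht0 (by ring)
    have e : (1 - t) • ((1 - (r : ℝ)) • p + (r : ℝ) • (x : E)) +
        t • ((1 - (r : ℝ)) • p + (r : ℝ) • (y : E)) = (1 - (r : ℝ)) • p + (r : ℝ) • (z : E) := by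
      rw [hz]; module
    rw [e, smul_eq_mul, smul_eq_mul] at h2
    simp only [rayExponent]
    rw [mul_div_assoc', mul_div_assoc', ← add_div]
    gcongr
    linarith
  calc ENNReal.ofReal (Real.exp (rayExponent q p r z))
      ≤ ENNReal.ofReal (Real.exp ((1 - t) * rayExponent q p r x + t * rayExponent q p r y)) :=
        ENNReal.ofReal_le_ofReal (Real.exp_le_exp.2 h1)
    _ = ENNReal.ofReal (Real.exp (rayExponent q p r x)) ^ (1 - t) *
          ENNReal.ofReal (Real.exp (rayExponent q p r y)) ^ t := by
        rw [ENNReal.ofReal_rpow_of_pos (Real.exp_pos _), ENNReal.ofReal_rpow_of_pos (Real.exp_pos _),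
          ← ENNReal.ofReal_mul (by positivity), ← Real.exp_mul, ← Real.exp_mul, ← Real.exp_add]
        ring_nf
    _ ≤ _ := mul_le_mul' (ENNReal.rpow_le_rpow (le_iSup (fun r : Ioo (0 : ℝ) 1 =>
          ENNReal.ofReal (Real.exp (rayExponent q p r x))) r) (sub_nonneg.2 ht1))
        (ENNReal.rpow_le_rpow (le_iSup (fun r : Ioo (0 : ℝ) 1 =>
          ENNReal.ofReal (Real.exp (rayExponent q p r y))) r) ht0)

/-- Convexity says that extrapolation from `p` never exceeds `q x`; continuity makes it tend to `q
x` as `r → 1`. -/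
theorem envelope_of_mem_interior (hp : p ∈ interior 𝒮.P) (hq : ConvexOn ℝ (interior 𝒮.P) q)
    (hqc : ContinuousOn q (interior 𝒮.P)) {x : 𝒮.P} (hx : (x : E) ∈ interior 𝒮.P) :
    𝒮.envelope q p x = ENNReal.ofReal (Real.exp (q x)) := by
  refine le_antisymm (iSup_le fun r => ?_) ?_
  · refine ENNReal.ofReal_le_ofReal (Real.exp_le_exp.2 ?_)
    have h := hq.2 hp hx (sub_nonneg.2 r.2.2.le) r.2.1.le (by ring)
    rw [smul_eq_mul, smul_eq_mul] at h
    rw [rayExponent, div_le_iff₀ r.2.1]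
    linarith
  · have hlim : Tendsto (fun r : ℝ => ENNReal.ofReal (Real.exp (rayExponent q p r x))) (𝓝[<] 1)
        (𝓝 (ENNReal.ofReal (Real.exp (q x)))) := by
      refine (ENNReal.continuous_ofReal.tendsto _).comp ((Real.continuous_exp.tendsto _).comp ?_)
      have hc : Continuous fun r : ℝ => (1 - r) • p + r • (x : E) := by fun_prop
      have h1 : Tendsto (fun r : ℝ => (1 - r) • p + r • (x : E)) (𝓝 1) (𝓝 (x : E)) :=
        hc.tendsto' 1 _ (by simp)
      have h2 := (hqc.continuousAt (isOpen_interior.mem_nhds hx)).tendsto.comp h1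
      have h3 : Tendsto (fun r : ℝ => (1 - r) * q p) (𝓝 1) (𝓝 0) := by
        have : Continuous fun r : ℝ => (1 - r) * q p := by fun_prop
        exact this.tendsto' 1 _ (by simp)
      have h4 := (h2.sub h3).div tendsto_id one_ne_zero
      simp only [sub_zero, div_one] at h4
      exact h4.mono_left nhdsWithin_le_nhds
    refine le_of_tendsto hlim ?_
    filter_upwards [Ioo_mem_nhdsLT (zero_lt_one' ℝ)] with r hr
    exact le_iSup (fun r : Ioo (0 : ℝ) 1 =>
      ENNReal.ofReal (Real.exp (rayExponent q p r x))) ⟨r, hr⟩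

/-- The envelope of an interior limit of log convex functions is bounded by their lower limit. -/
theorem envelope_le_liminf {v : ℕ → E → ℝ≥0∞} (hv : ∀ n, LogConvexOn 𝒮.P (v n))
    (hp : p ∈ interior 𝒮.P)
    (hlim : ∀ y ∈ interior 𝒮.P,
      Tendsto (fun n => v n y) atTop (𝓝 (ENNReal.ofReal (Real.exp (q y))))) (x : 𝒮.P) :
    𝒮.envelope q p x ≤ liminf (fun n => v n x) atTop := by
  refine iSup_le fun r => ?_
  -- If `v n x < b` infinitely often, log convexity between `p` and `x` passes to the limit in the
  -- interior; solved for `b`, it says that the extrapolated value is at most `b`.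
  by_contra! hlt
  obtain ⟨b, hb1, hb2⟩ := exists_between hlt
  have hbtop : b ≠ ∞ := ne_top_of_lt hb2
  have hr := r.2.1
  have hr1 := r.2.2
  have hfreq : ∃ᶠ n in atTop, v n x < b := frequently_lt_of_liminf_lt (by isBoundedDefault) hb1
  have hfreq2 : ∃ᶠ n in atTop, v n ((1 - (r : ℝ)) • p + (r : ℝ) • (x : E)) ≤
      v n p ^ (1 - (r : ℝ)) * b ^ (r : ℝ) := by
    refine hfreq.mono fun n hn => (hv n p (interior_subset hp) x x.2 r hr.le hr1.le).trans ?_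
    gcongr
  have h1 : Tendsto (fun n => v n p ^ (1 - (r : ℝ)) * b ^ (r : ℝ)) atTop
      (𝓝 (ENNReal.ofReal (Real.exp (q p)) ^ (1 - (r : ℝ)) * b ^ (r : ℝ))) := by
    refine ENNReal.Tendsto.mul_const ((ENNReal.continuous_rpow_const.tendsto _).comp (hlim p hp))
      (Or.inr (ENNReal.rpow_ne_top_of_nonneg hr.le hbtop))
  have h2 := le_of_tendsto_of_tendsto_of_frequently (hlim _ (combo_mem_interior hp r x.2)) h1 hfreq2
  lift b to NNReal using hbtop
  have h3 := ENNReal.rpow_lt_rpow hb2 hr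
  have e1 : ENNReal.ofReal (Real.exp (rayExponent q p r x)) ^ (r : ℝ) *
      ENNReal.ofReal (Real.exp (q p)) ^ (1 - (r : ℝ)) =
      ENNReal.ofReal (Real.exp (q ((1 - (r : ℝ)) • p + (r : ℝ) • (x : E)))) := by
    rw [ENNReal.ofReal_rpow_of_pos (Real.exp_pos _), ENNReal.ofReal_rpow_of_pos (Real.exp_pos _),
      ← ENNReal.ofReal_mul (by positivity), ← Real.exp_mul, ← Real.exp_mul, ← Real.exp_add,
      rayExponent, div_mul_cancel₀ _ hr.ne']
    ring_nf
  rw [← e1, mul_comm (_ ^ (r : ℝ))] at h2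
  have h0 : ENNReal.ofReal (Real.exp (q p)) ^ (1 - (r : ℝ)) ≠ 0 :=
    (ENNReal.rpow_pos (ENNReal.ofReal_pos.2 (Real.exp_pos _)) ENNReal.ofReal_ne_top).ne'
  have h0' : ENNReal.ofReal (Real.exp (q p)) ^ (1 - (r : ℝ)) ≠ ∞ :=
    ENNReal.rpow_ne_top_of_nonneg (by linarith) ENNReal.ofReal_ne_top
  rw [ENNReal.mul_le_mul_iff_right h0 h0'] at h2
  exact absurd h2 (not_le.2 h3)

variable [BorelSpace E] [FiniteDimensional ℝ E]

/-- Finite limits exclude `0 * ∞`, so the product of powers converges. -/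
theorem logConvexOn_of_tendsto {v : ℕ → E → ℝ≥0∞} {w : E → ℝ≥0∞} {s : Set E}
    (hs : Convex ℝ s) (hv : ∀ n, LogConvexOn s (v n))
    (hw : ∀ y ∈ s, w y ≠ ∞ ∧ Tendsto (fun n => v n y) atTop (𝓝 (w y))) : LogConvexOn s w := by
  intro x hx y hy t ht0 ht1
  have hz : (1 - t) • x + t • y ∈ s := hs hx hy (sub_nonneg.2 ht1) ht0 (by ring)
  refine le_of_tendsto_of_tendsto' (hw _ hz).2 (ENNReal.Tendsto.mul
    ((ENNReal.continuous_rpow_const.tendsto _).comp (hw x hx).2) (Or.inr ?_)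
    ((ENNReal.continuous_rpow_const.tendsto _).comp (hw y hy).2) (Or.inr ?_))
    fun n => hv n x hx y hy t ht0 ht1
  · exact ENNReal.rpow_ne_top_of_nonneg ht0 (hw y hy).1
  · exact ENNReal.rpow_ne_top_of_nonneg (sub_nonneg.2 ht1) (hw x hx).1

/-- A log convex function on an open set which has a zero vanishes identically. -/
theorem _root_.MuEntropy.LogConvexOn.eq_zero_of_eq_zero {w : E → ℝ≥0∞} {s : Set E}
    (hs : IsOpen s) (hw : LogConvexOn s w) {y : E} (hy : y ∈ s)
    (hy0 : w y = 0) {z : E} (hz : z ∈ s) : w z = 0 := by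
  have hc : Tendsto (fun δ : ℝ => z + δ • (z - y)) (𝓝 0) (𝓝 z) := by
    have : Continuous fun δ : ℝ => z + δ • (z - y) := by fun_prop
    exact this.tendsto' 0 _ (by simp)
  -- Continue slightly beyond `z` on the ray from `y`: then `z` is a convex combination giving `y`
  -- positive weight, and the zero at `y` kills the bound.
  obtain ⟨δ, hδs, hδ⟩ := (((hc.eventually (hs.mem_nhds hz)).filter_mono
    (nhdsWithin_le_nhds (s := Ioi 0))).and self_mem_nhdsWithin).exists
  have hδ0 : 0 < δ := hδ
  have h1 := hw _ hδs y hy (δ / (1 + δ)) (by positivity) (by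
    rw [div_le_one (by positivity)]; linarith)
  have e : (1 - δ / (1 + δ)) • (z + δ • (z - y)) + (δ / (1 + δ)) • y = z := by
    have h2 : (1 - δ / (1 + δ)) = 1 / (1 + δ) := by field_simp; ring
    have h3 : δ / (1 + δ) = (1 / (1 + δ)) * δ := by ring
    have h4 : z = (1 / (1 + δ)) • ((1 + δ) • z) := by
      rw [smul_smul, one_div_mul_cancel (by positivity), one_smul]
    rw [h2, h3]
    conv_rhs => rw [h4]
    module
  rw [e, hy0, ENNReal.zero_rpow_of_pos (by positivity), mul_zero] at h1
  exact le_antisymm h1 zero_le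

end System
end MuEntropy

/-! ### Limit states and lower semicontinuity. -/

namespace MuEntropy
namespace System

variable {E : Type*} [NormedAddCommGroup E] [NormedSpace ℝ E] [MeasurableSpace E] {𝒮 : System E}
  [BorelSpace E] [FiniteDimensional ℝ E]

/-- States which converge almost everywhere without loss of mass converge to a state, whose
boundary values are bounded by the lower limit of the boundary values. -/
theorem exists_isState_of_tendsto_ae {v : ℕ → 𝒮.P → ℝ≥0∞} (hv : ∀ n, 𝒮.IsState (v n))
    {g : 𝒮.P → ℝ≥0∞} (hg : ∫⁻ x, g x ∂𝒮.bulk = 𝒮.μ 𝒮.P)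
    (hae : ∀ᵐ x ∂𝒮.bulk, Tendsto (fun n => v n x) atTop (𝓝 (g x))) :
    ∃ u, 𝒮.IsState u ∧ u =ᵐ[𝒮.bulk] g ∧ ∀ x, u x ≤ liminf (fun n => v n x) atTop := by
  obtain ⟨p, hp⟩ := 𝒮.simple.1.2.1
  obtain ⟨w, hw⟩ := exists_tendsto_interior hv hae
  have hS := 𝒮.convex_P.interior
  have hwlog : LogConvexOn (interior 𝒮.P) w :=
    logConvexOn_of_tendsto hS (fun n => (hv n).logConvexOn_ext.mono interior_subset) hw
  have hint : ∀ᵐ x : 𝒮.P ∂𝒮.bulk, (x : E) ∈ interior 𝒮.P := ae_bulk_iff.2 ae_mem_interior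
  have hwg : ∀ᵐ x : 𝒮.P ∂𝒮.bulk, w x = g x := by
    filter_upwards [hint, hae] with x hx hx'
    refine tendsto_nhds_unique (hw x hx).2 ?_
    simpa using hx'
  -- A zero would make `w` vanish throughout the interior, contradicting the preserved mass; so `log
  -- w` is a real convex function.
  have hw0 : ∀ y ∈ interior 𝒮.P, w y ≠ 0 := by
    intro y hy hy0
    refine μ_P_ne_zero (𝒮 := 𝒮) ?_
    rw [← hg]
    refine lintegral_eq_zero_of_ae_eq_zero ?_
    filter_upwards [hint, hwg] with x hx hx'
    rw [← hx', hwlog.eq_zero_of_eq_zero isOpen_interior hy hy0 hx]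
    rfl
  set q : E → ℝ := fun y => Real.log (w y).toReal with hq
  have hwq : ∀ y ∈ interior 𝒮.P, w y = ENNReal.ofReal (Real.exp (q y)) := by
    intro y hy
    rw [hq, Real.exp_log (ENNReal.toReal_pos (hw0 y hy) (hw y hy).1),
      ENNReal.ofReal_toReal (hw y hy).1]
  have hqconv : ConvexOn ℝ (interior 𝒮.P) q := by
    refine ⟨hS, fun x hx y hy a b ha hb hab => ?_⟩
    obtain rfl : a = 1 - b := by linarith
    have h := hwlog x hx y hy b hb (by linarith)
    rw [hwq x hx, hwq y hy, hwq _ (hS hx hy ha hb hab),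
      ENNReal.ofReal_rpow_of_pos (Real.exp_pos _), ENNReal.ofReal_rpow_of_pos (Real.exp_pos _),
      ← ENNReal.ofReal_mul (by positivity), ← Real.exp_mul, ← Real.exp_mul, ← Real.exp_add,
      ENNReal.ofReal_le_ofReal_iff (Real.exp_pos _).le, Real.exp_le_exp] at h
    rw [smul_eq_mul, smul_eq_mul]
    linarith
  have hqcont : ContinuousOn q (interior 𝒮.P) := hqconv.continuousOn isOpen_interior
  have hug : 𝒮.envelope q p =ᵐ[𝒮.bulk] g := by
    filter_upwards [hint, hwg] with x hx hx'
    rw [envelope_of_mem_interior hp hqconv hqcont hx, ← hx', hwq x hx]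
  refine ⟨𝒮.envelope q p, ⟨envelope_pos, lowerSemicontinuous_envelope hp hqcont,
    logConvex_envelope hp hqconv, ?_⟩, hug, fun x => ?_⟩
  · rw [lintegral_congr_ae hug, hg]
  · have := envelope_le_liminf (fun n => (hv n).logConvexOn_ext) hp
      (fun y hy => hwq y hy ▸ (hw y hy).2) x
    simpa using this

/-- Adding one makes the integrand non-negative, so that Fatou's lemma applies. -/
theorem IsFiniteState.lintegral_mul_log_add_one {u : 𝒮.P → ℝ≥0∞} (hu : 𝒮.IsFiniteState u) :
    ∫⁻ x, ENNReal.ofReal ((u x).toReal * Real.log (u x).toReal + 1) ∂𝒮.bulk =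
      ENNReal.ofReal (𝒮.relEntropy u + 𝒮.mass) := by
  have hi : Integrable (fun x => (u x).toReal * Real.log (u x).toReal + 1) 𝒮.bulk :=
    hu.integrable_mul_log.add (integrable_const 1)
  rw [← ofReal_integral_eq_lintegral_ofReal hi,
    integral_add hu.integrable_mul_log (integrable_const 1), integral_const, measureReal_def,
    bulk_univ, smul_eq_mul, mul_one]
  · rfl
  · refine Eventually.of_forall fun x => ?_
    have h1 := sub_add_sq_sqrt_sub_sqrt_le (ENNReal.toReal_nonneg (a := u x)) one_pos
    rw [Real.log_one, mul_zero, sub_zero] at h1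
    have := sq_nonneg (√(u x).toReal - √1)
    have h2 := ENNReal.toReal_nonneg (a := u x)
    change 0 ≤ (u x).toReal * Real.log (u x).toReal + 1
    linarith

/-- Lower semicontinuity of the energy and of `∫ u log u dμ`, for sequences of states whose square
roots are Cauchy in `L²`. -/
theorem exists_limit_state {u : ℕ → 𝒮.P → ℝ≥0∞} (hu : ∀ n, 𝒮.IsFiniteState (u n))
    (hcau : ∀ ε > 0, ∃ N, ∀ m ≥ N, ∀ n ≥ N,
      ∫ x, (√(u m x).toReal - √(u n x).toReal) ^ 2 ∂𝒮.bulk ≤ ε)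
    {c : ℝ≥0∞} (hc : c ≠ ∞) (hU : ∀ b, c < b → ∀ᶠ n in atTop, 𝒮.energy (u n) ≤ b)
    {H : ℝ} (hH : ∀ b, H < b → ∀ᶠ n in atTop, 𝒮.relEntropy (u n) ≤ b) :
    ∃ w, 𝒮.IsFiniteState w ∧ 𝒮.energy w ≤ c ∧ 𝒮.relEntropy w ≤ H := by
  obtain ⟨φ, g, hφ, hg, hgtop, hae⟩ := exists_subseq_tendsto_ae (fun n => (hu n).1) hcau
  obtain ⟨w, hw, hwg, hle⟩ := exists_isState_of_tendsto_ae (fun n => (hu (φ n)).1) hg hae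
  -- Convergence `μ`-almost everywhere says nothing about `σ`; the pointwise bound by the lower
  -- limit, valid on the boundary too, feeds Fatou's lemma.
  have hEw : 𝒮.energy w ≤ c := by
    refine le_of_forall_gt_imp_ge_of_dense fun b hb => ?_
    have h1 : ∫⁻ x, w x ∂𝒮.bdry ≤ b * 𝒮.μ 𝒮.P := by
      calc ∫⁻ x, w x ∂𝒮.bdry ≤ ∫⁻ x, liminf (fun n => u (φ n) x) atTop ∂𝒮.bdry :=
            lintegral_mono hle
        _ ≤ liminf (fun n => ∫⁻ x, u (φ n) x ∂𝒮.bdry) atTop :=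
            lintegral_liminf_le fun n => (hu (φ n)).1.measurable
        _ ≤ b * 𝒮.μ 𝒮.P := by
            refine liminf_le_of_frequently_le' (Eventually.frequently ?_)
            filter_upwards [hφ.tendsto_atTop.eventually (hU b hb)] with n hn
            rw [lintegral_bdry_eq]
            gcongr
    rw [lintegral_bdry_eq] at h1
    exact (ENNReal.mul_le_mul_iff_left μ_P_ne_zero μ_P_ne_top).1 h1
  have hwf : 𝒮.IsFiniteState w := ⟨hw, ne_top_of_le_ne_top hc hEw⟩
  refine ⟨w, hwf, hEw, le_of_forall_gt_imp_ge_of_dense fun b hb => ?_⟩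
  have hb0 : 0 ≤ b := by
    obtain ⟨n, hn⟩ := (hH b hb).exists
    exact (hu n).relEntropy_nonneg.trans hn
  have h1 : ENNReal.ofReal (𝒮.relEntropy w + 𝒮.mass) ≤ ENNReal.ofReal (b + 𝒮.mass) := by
    calc ENNReal.ofReal (𝒮.relEntropy w + 𝒮.mass)
        = ∫⁻ x, ENNReal.ofReal ((w x).toReal * Real.log (w x).toReal + 1) ∂𝒮.bulk :=
          hwf.lintegral_mul_log_add_one.symm
      _ = ∫⁻ x, liminf (fun n => ENNReal.ofReal ((u (φ n) x).toReal *
            Real.log (u (φ n) x).toReal + 1)) atTop ∂𝒮.bulk := by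
          refine lintegral_congr_ae ?_
          filter_upwards [hae, hwg] with x hx hx'
          rw [hx']
          have h2 := (ENNReal.tendsto_toReal (hgtop x)).comp hx
          have h3 := (Real.continuous_mul_log.tendsto _).comp h2
          have h4 := (ENNReal.continuous_ofReal.tendsto _).comp (h3.add_const 1)
          exact h4.liminf_eq.symm
      _ ≤ liminf (fun n => ∫⁻ x, ENNReal.ofReal ((u (φ n) x).toReal *
            Real.log (u (φ n) x).toReal + 1) ∂𝒮.bulk) atTop := by
          refine lintegral_liminf_le fun n => ?_
          have := (hu (φ n)).1.measurable.ennreal_toReal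
          exact ((this.mul (Real.measurable_log.comp this)).add_const 1).ennreal_ofReal
      _ ≤ ENNReal.ofReal (b + 𝒮.mass) := by
          refine liminf_le_of_frequently_le' (Eventually.frequently ?_)
          filter_upwards [hφ.tendsto_atTop.eventually (hH b hb)] with n hn
          rw [(hu (φ n)).lintegral_mul_log_add_one]
          exact ENNReal.ofReal_le_ofReal (by linarith)
  have h2 := 𝒮.mass_pos
  rw [ENNReal.ofReal_le_ofReal_iff (by linarith)] at h1
  linarith

end System
end MuEntropy

/-! ### Constrained maximizers, Lagrange multipliers and canonical distributions. -/

namespace MuEntropy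
namespace System

variable {E : Type*} [NormedAddCommGroup E] [NormedSpace ℝ E] [MeasurableSpace E]

/-- `u` maximizes the entropy among the states of energy at most `c`. -/
def IsOptimal (𝒮 : System E) (c : ℝ≥0∞) (u : 𝒮.P → ℝ≥0∞) : Prop :=
  𝒮.IsFiniteState u ∧ 𝒮.energy u ≤ c ∧
    ∀ v, 𝒮.IsFiniteState v → 𝒮.energy v ≤ c → 𝒮.relEntropy u ≤ 𝒮.relEntropy v

variable {𝒮 : System E} [BorelSpace E] [FiniteDimensional ℝ E]

theorem energy_mix_le {u v : 𝒮.P → ℝ≥0∞} (hu : Measurable u) (hv : Measurable v) {c : ℝ≥0∞}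
    (huc : 𝒮.energy u ≤ c) (hvc : 𝒮.energy v ≤ c) {t : ℝ} (ht0 : 0 ≤ t) (ht1 : t ≤ 1) :
    𝒮.energy (𝒮.mix t u v) ≤ c := by
  rw [energy_mix hv hu]
  calc ENNReal.ofReal (1 - t) * 𝒮.energy u + ENNReal.ofReal t * 𝒮.energy v
      ≤ ENNReal.ofReal (1 - t) * c + ENNReal.ofReal t * c := by gcongr
    _ = c := by
      rw [← add_mul, ← ENNReal.ofReal_add (sub_nonneg.2 ht1) ht0]
      simp

/-- The midpoint still satisfies the energy constraint, so it cannot lie strictly lower. -/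
theorem IsOptimal.eq_of_le {u v : 𝒮.P → ℝ≥0∞} {c : ℝ≥0∞} (hu : 𝒮.IsOptimal c u)
    (hv : 𝒮.IsFiniteState v) (hvc : 𝒮.energy v ≤ c) (h : 𝒮.relEntropy v ≤ 𝒮.relEntropy u) :
    v = u := by
  refine (hu.1.eq_of_le_relEntropy_midpoint hv ?_).symm
  have := hu.2.2 _ (hu.1.mix hv (t := 1 / 2) (by norm_num) (by norm_num))
    (energy_mix_le hu.1.1.measurable hv.1.measurable hu.2.1 hvc (by norm_num) (by norm_num))
  linarith

/-- The constraint is relaxed to `c + δ n`, because at `c` equal to the infimum of the energy no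
admissible state is known yet. The relaxed infima increase and are bounded by the entropy-energy
estimate, so near-minimizers at growing levels form a Cauchy sequence. -/
theorem exists_isOptimal {c : ℝ≥0∞} (hc : c ≠ ∞)
    (hne : ∀ b, c < b → ∃ v, 𝒮.IsState v ∧ 𝒮.energy v ≤ b) : ∃ u, 𝒮.IsOptimal c u := by
  obtain ⟨K, hK0, hK⟩ := 𝒮.exists_relEntropy_le
  let δ : ℕ → ℝ≥0∞ := fun n => ((n : ℝ≥0∞) + 1)⁻¹
  have hδ0 : ∀ n, δ n ≠ 0 := fun n => by simp [δ]
  have hδ1 : ∀ n, δ n ≤ 1 := fun n => by simp [δ]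
  have hδanti : Antitone δ := fun m n hmn => by
    simp only [δ]; gcongr
  have hδlim : Tendsto (fun n => c + δ n) atTop (𝓝 c) := by
    have h1 : Tendsto δ atTop (𝓝 0) := by
      have := (tendsto_add_atTop_iff_nat 1).2 ENNReal.tendsto_inv_nat_nhds_zero
      simpa [δ] using this
    simpa using (tendsto_const_nhds (x := c)).add h1
  have hctop : ∀ n, c + δ n ≠ ∞ := fun n =>
    ENNReal.add_ne_top.2 ⟨hc, ne_top_of_le_ne_top ENNReal.one_ne_top (hδ1 n)⟩
  let A : ℕ → Set ℝ := fun n =>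
    {r | ∃ v, 𝒮.IsFiniteState v ∧ 𝒮.energy v ≤ c + δ n ∧ 𝒮.relEntropy v = r}
  have hAne : ∀ n, (A n).Nonempty := by
    intro n
    obtain ⟨v, hv, hvb⟩ := hne (c + δ n) (ENNReal.lt_add_right hc (hδ0 n))
    exact ⟨_, v, ⟨hv, ne_top_of_le_ne_top (hctop n) hvb⟩, hvb, rfl⟩
  have hAbdd : ∀ n, BddBelow (A n) := by
    refine fun n => ⟨0, ?_⟩
    rintro _ ⟨v, hv, -, rfl⟩
    exact hv.relEntropy_nonneg
  let h : ℕ → ℝ := fun n => sInf (A n)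
  have hmono : Monotone h := by
    refine fun m n hmn => csInf_le_csInf (hAbdd m) (hAne n) ?_
    rintro _ ⟨v, hv, hvn, rfl⟩
    exact ⟨v, hv, hvn.trans (by gcongr; exact hδanti hmn), rfl⟩
  have hbdd : BddAbove (range h) := by
    refine ⟨K * (1 + (c + 1).toReal), ?_⟩
    rintro _ ⟨n, rfl⟩
    obtain ⟨_, v, hv, hvn, rfl⟩ := hAne n
    refine (csInf_le (hAbdd n) ⟨v, hv, hvn, rfl⟩).trans ((hK v hv).trans ?_)
    gcongr
    · exact ENNReal.add_ne_top.2 ⟨hc, ENNReal.one_ne_top⟩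
    · exact hvn.trans (by gcongr; exact hδ1 n)
  set H := ⨆ n, h n with hH
  have hlim : Tendsto h atTop (𝓝 H) := tendsto_atTop_ciSup hmono hbdd
  have hle : ∀ n, h n ≤ H := le_ciSup hbdd
  have hex : ∀ n : ℕ, ∃ v, 𝒮.IsFiniteState v ∧ 𝒮.energy v ≤ c + δ n ∧
      𝒮.relEntropy v < h n + 1 / ((n : ℝ) + 1) := by
    intro n
    obtain ⟨_, ⟨v, hv, hvn, rfl⟩, hlt⟩ := exists_lt_of_csInf_lt (hAne n)
      (show sInf (A n) < h n + 1 / ((n : ℝ) + 1) from lt_add_of_pos_right _ (by positivity))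
    exact ⟨v, hv, hvn, hlt⟩
  choose u hu hun huh using hex
  have hinv : ∀ {N n : ℕ}, N ≤ n → 1 / ((n : ℝ) + 1) ≤ 1 / ((N : ℝ) + 1) := fun hNn =>
    Nat.one_div_le_one_div hNn
  have hinvlim : Tendsto (fun n : ℕ => 1 / ((n : ℝ) + 1)) atTop (𝓝 0) :=
    tendsto_one_div_add_atTop_nhds_zero_nat
  have hcau : ∀ ε > 0, ∃ N, ∀ m ≥ N, ∀ n ≥ N,
      ∫ x, (√(u m x).toReal - √(u n x).toReal) ^ 2 ∂𝒮.bulk ≤ ε := by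
    intro ε hε
    have h1 : Tendsto (fun N : ℕ => 4 * (H + 1 / ((N : ℝ) + 1) - h N)) atTop (𝓝 0) := by
      have := ((hinvlim.const_add H).sub hlim).const_mul 4
      simpa using this
    obtain ⟨N, hN⟩ := (h1.eventually (gt_mem_nhds hε)).exists
    refine ⟨N, fun m hm n hn => ?_⟩
    have h2 := (hu m).relEntropy_midpoint_le (hu n)
    -- The midpoint competes at the weaker level `N`; its gap to both near-minimizers is at most `H
    -- + 1 / (N + 1) - h N`, which tends to zero.
    have h3 : h N ≤ 𝒮.relEntropy (𝒮.mix (1 / 2) (u m) (u n)) := by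
      refine csInf_le (hAbdd N) ⟨_, (hu m).mix (hu n) (by norm_num) (by norm_num), ?_, rfl⟩
      refine energy_mix_le (hu m).1.measurable (hu n).1.measurable ((hun m).trans ?_)
        ((hun n).trans ?_) (by norm_num) (by norm_num)
      · gcongr; exact hδanti hm
      · gcongr; exact hδanti hn
    have h4 := huh m
    have h5 := huh n
    have h6 := hle m
    have h7 := hle n
    have h8 := hinv hm
    have h9 := hinv hn
    linarith
  have hE : ∀ b, c < b → ∀ᶠ n in atTop, 𝒮.energy (u n) ≤ b := by
    intro b hb
    filter_upwards [hδlim.eventually (gt_mem_nhds hb)] with n hn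
    exact (hun n).trans hn.le
  have hR : ∀ b, H < b → ∀ᶠ n in atTop, 𝒮.relEntropy (u n) ≤ b := by
    intro b hb
    have h1 : Tendsto (fun n : ℕ => H + 1 / ((n : ℝ) + 1)) atTop (𝓝 H) := by
      simpa using hinvlim.const_add H
    filter_upwards [h1.eventually (gt_mem_nhds hb)] with n hn
    have h2 := huh n
    have h3 := hle n
    linarith
  obtain ⟨w, hw, hwc, hwH⟩ := exists_limit_state hu hcau hc hE hR
  refine ⟨w, hw, hwc, fun v hv hvc => hwH.trans (ciSup_le fun n => ?_)⟩
  exact csInf_le (hAbdd n) ⟨v, hv, hvc.trans le_self_add, rfl⟩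

theorem IsFiniteState.eq_one_of_relEntropy_le {u : 𝒮.P → ℝ≥0∞} (hu : 𝒮.IsFiniteState u)
    (h : 𝒮.relEntropy u ≤ 0) : u = 𝒮.one := by
  refine hu.eq_of_le_relEntropy_midpoint isFiniteState_one ?_
  have := (hu.mix isFiniteState_one (t := 1 / 2) (by norm_num) (by norm_num)).relEntropy_nonneg
  rw [relEntropy_one]
  linarith

theorem IsFiniteState.energy_le_iff {u v : 𝒮.P → ℝ≥0∞} (hu : 𝒮.IsFiniteState u)
    (hv : 𝒮.IsFiniteState v) :
    𝒮.energy u ≤ 𝒮.energy v ↔ (𝒮.energy u).toReal ≤ (𝒮.energy v).toReal :=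
  (ENNReal.toReal_le_toReal hu.2 hv.2).symm

/-- Below the energy of the constant state, the energy constraint is sharp. -/
theorem IsOptimal.energy_eq {u : 𝒮.P → ℝ≥0∞} {U : ℝ≥0∞} (hu : 𝒮.IsOptimal U u)
    (hU : U ≤ 𝒮.energy 𝒮.one) : 𝒮.energy u = U := by
  by_contra hne
  have hlt : 𝒮.energy u < U := hu.2.1.lt_of_ne hne
  have hUtop : U ≠ ∞ := ne_top_of_le_ne_top isFiniteState_one.2 hU
  have hpos : 0 < 𝒮.relEntropy u := by
    by_contra! h
    rw [hu.1.eq_one_of_relEntropy_le h] at hlt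
    exact absurd hU (not_le.2 hlt)
  rcases hU.eq_or_lt with rfl | hU
  · have := hu.2.2 _ isFiniteState_one le_rfl
    rw [relEntropy_one] at this
    linarith
  have h1 := (ENNReal.toReal_lt_toReal hu.1.2 hUtop).2 hlt
  have h2 := (ENNReal.toReal_lt_toReal hUtop isFiniteState_one.2).2 hU
  set e := (𝒮.energy u).toReal
  set e₁ := (𝒮.energy 𝒮.one).toReal with he₁
  -- With this weight the mixture with `1_P` has energy exactly `U`, while its `relEntropy` is at
  -- most `1 - t` times that of `u`.
  set t := (U.toReal - e) / (e₁ - e) with ht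
  have hd : 0 < e₁ - e := by linarith
  have ht0 : 0 < t := div_pos (by linarith) hd
  have ht1 : t < 1 := by rw [ht, div_lt_one hd]; linarith
  have hmix := hu.1.mix isFiniteState_one ht0 ht1
  have hE := hu.1.toReal_energy_mix isFiniteState_one ht0 ht1
  have hE' : (𝒮.energy (𝒮.mix t u 𝒮.one)).toReal = U.toReal := by
    rw [hE, ← he₁]
    have : t * (e₁ - e) = U.toReal - e := by rw [ht, div_mul_cancel₀ _ hd.ne']
    change (1 - t) * e + t * e₁ = _
    linarith
  have h3 := hu.2.2 _ hmix ((ENNReal.toReal_eq_toReal_iff' hmix.2 hUtop).1 hE').le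
  have h4 := hu.1.relEntropy_mix_le isFiniteState_one ht0 ht1
  rw [relEntropy_one] at h4
  nlinarith

/-- Existence of a Lagrange multiplier. -/
theorem IsOptimal.exists_multiplier {u w : 𝒮.P → ℝ≥0∞} {U : ℝ≥0∞} (hu : 𝒮.IsOptimal U u)
    (huU : 𝒮.energy u = U) (hU : U < 𝒮.energy 𝒮.one) (hw : 𝒮.IsFiniteState w)
    (hwU : 𝒮.energy w < U) :
    ∃ β : ℝ, 0 < β ∧ ∀ v, 𝒮.IsFiniteState v →
      𝒮.relEntropy u + β * (𝒮.energy u).toReal ≤ 𝒮.relEntropy v + β * (𝒮.energy v).toReal := by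
  subst huU
  set e := (𝒮.energy u).toReal with he
  have hopt : ∀ v, 𝒮.IsFiniteState v → (𝒮.energy v).toReal ≤ e →
      𝒮.relEntropy u ≤ 𝒮.relEntropy v := fun v hv hve =>
    hu.2.2 v hv ((hv.energy_le_iff hu.1).2 hve)
  -- Secant slopes through `u` towards higher energy stay below those from lower energy: mix `w` and
  -- `v` so that the energy is exactly `e`, and use optimality of `u`.
  have hcross : ∀ v, 𝒮.IsFiniteState v → e < (𝒮.energy v).toReal → ∀ w, 𝒮.IsFiniteState w →
      (𝒮.energy w).toReal < e → (𝒮.relEntropy u - 𝒮.relEntropy v) / ((𝒮.energy v).toReal - e) ≤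
        (𝒮.relEntropy w - 𝒮.relEntropy u) / (e - (𝒮.energy w).toReal) := by
    intro v hv hve w hw hwe
    set b := (𝒮.energy v).toReal - e with hb
    set a := e - (𝒮.energy w).toReal with ha
    have ha0 : 0 < a := by linarith
    have hb0 : 0 < b := by linarith
    have ht0 : 0 < a / (a + b) := by positivity
    have ht1 : a / (a + b) < 1 := by rw [div_lt_one (by positivity)]; linarith
    have ht : 1 - a / (a + b) = b / (a + b) := by field_simp; ring
    have h1 := hw.toReal_energy_mix hv ht0 ht1
    have h2 := hw.relEntropy_mix_le hv ht0 ht1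
    have h3 := hopt _ (hw.mix hv ht0 ht1) (by
      rw [h1, ht]
      have e1 : (𝒮.energy w).toReal = e - a := by rw [ha]; ring
      have e2 : (𝒮.energy v).toReal = e + b := by rw [hb]; ring
      rw [e1, e2]
      refine le_of_eq ?_
      field_simp
      ring)
    rw [ht] at h2
    have h4 := h3.trans h2
    have h5 : b / (a + b) * 𝒮.relEntropy w + a / (a + b) * 𝒮.relEntropy v =
        (b * 𝒮.relEntropy w + a * 𝒮.relEntropy v) / (a + b) := by ring
    rw [h5, le_div_iff₀ (by positivity)] at h4
    rw [div_le_div_iff₀ hb0 ha0]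
    linarith
  have hwe : (𝒮.energy w).toReal < e := (ENNReal.toReal_lt_toReal hw.2 hu.1.2).2 hwU
  have h1e : e < (𝒮.energy 𝒮.one).toReal :=
    (ENNReal.toReal_lt_toReal hu.1.2 isFiniteState_one.2).2 hU
  let A : Set ℝ := {r | ∃ v, 𝒮.IsFiniteState v ∧ e < (𝒮.energy v).toReal ∧
    (𝒮.relEntropy u - 𝒮.relEntropy v) / ((𝒮.energy v).toReal - e) = r}
  have hAb : ∀ w, 𝒮.IsFiniteState w → (𝒮.energy w).toReal < e →
      (𝒮.relEntropy w - 𝒮.relEntropy u) / (e - (𝒮.energy w).toReal) ∈ upperBounds A := by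
    rintro w hw hwe _ ⟨v, hv, hve, rfl⟩
    exact hcross v hv hve w hw hwe
  have hbdd : BddAbove A := ⟨_, hAb w hw hwe⟩
  have hone : (𝒮.relEntropy u - 𝒮.relEntropy 𝒮.one) / ((𝒮.energy 𝒮.one).toReal - e) ∈ A :=
    ⟨_, isFiniteState_one, h1e, rfl⟩
  have hpos : 0 < 𝒮.relEntropy u := by
    by_contra! h
    rw [hu.1.eq_one_of_relEntropy_le h] at hU
    exact lt_irrefl _ hU
  -- The supremum of the slopes on the right separates the two families. The given `w` bounds it,
  -- and the slope towards `1_P` makes it positive.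
  refine ⟨sSup A, ?_, fun v hv => ?_⟩
  · refine lt_of_lt_of_le ?_ (le_csSup hbdd hone)
    rw [relEntropy_one, sub_zero]
    exact div_pos hpos (by linarith)
  · rcases lt_trichotomy (𝒮.energy v).toReal e with hve | hve | hve
    · have h1 := csSup_le ⟨_, hone⟩ (hAb v hv hve)
      rw [le_div_iff₀ (by linarith)] at h1
      linarith
    · rw [hve]
      linarith [hopt v hv hve.le]
    · have h1 := le_csSup hbdd (show _ ∈ A from ⟨v, hv, hve, rfl⟩)
      rw [div_le_iff₀ (by linarith)] at h1
      linarith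

/-- The negative part of `u log u` has finite integral, so only `-∞` can occur. Hence infinite
energy forces infinite free energy for every real `T`. -/
theorem entropy_ne_top (v : 𝒮.P → ℝ≥0∞) : 𝒮.entropy v ≠ ⊤ := by
  have hB := lintegral_mulLogNeg_ne_top v
  have h2 : ((𝒮.μ 𝒮.P : ℝ≥0∞) : EReal) = ((𝒮.mass : ℝ) : EReal) := by
    rw [mass, EReal.coe_ennreal_toReal μ_P_ne_top]
  have h1 : eintegral 𝒮.bulk (fun x => (v x : EReal) * ENNReal.log (v x)) =
      ((∫⁻ x, mulLogPos (v x) ∂𝒮.bulk : ℝ≥0∞) : EReal) -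
        (((∫⁻ x, mulLogNeg (v x) ∂𝒮.bulk).toReal : ℝ) : EReal) := by
    rw [EReal.coe_ennreal_toReal hB]
    rfl
  rw [entropy, h1, h2]
  have hm := 𝒮.mass_pos
  rcases eq_or_ne (∫⁻ x, mulLogPos (v x) ∂𝒮.bulk) ∞ with h | h
  · rw [h, EReal.coe_ennreal_top, EReal.top_sub_coe, EReal.top_div_of_pos_ne_top
      (by exact_mod_cast hm) (EReal.coe_ne_top _)]
    simp
  · rw [← EReal.coe_ennreal_toReal h, ← EReal.coe_sub, ← EReal.coe_div, ← EReal.coe_neg]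
    exact EReal.coe_ne_top _

theorem freeEnergy_zero_ge (v : 𝒮.P → ℝ≥0∞) : (𝒮.energy v : EReal) ≤ 𝒮.freeEnergy 0 v := by
  rw [freeEnergy]
  split_ifs
  · exact le_top
  · simp

theorem IsFiniteState.freeEnergy_eq {u : 𝒮.P → ℝ≥0∞} (hu : 𝒮.IsFiniteState u) (T : ℝ) :
    𝒮.freeEnergy T u = (((𝒮.energy u).toReal + T * (𝒮.relEntropy u / 𝒮.mass) : ℝ) : EReal) := by
  rw [freeEnergy, if_neg hu.entropy_ne_bot, hu.entropy_eq, ← EReal.coe_ennreal_toReal hu.2,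
    ← EReal.coe_mul, ← EReal.coe_sub]
  congr 1
  ring

theorem freeEnergy_eq_top {v : 𝒮.P → ℝ≥0∞} (hv : 𝒮.energy v = ∞) (T : ℝ) :
    𝒮.freeEnergy T v = ⊤ := by
  rw [freeEnergy]
  split_ifs with h
  · rfl
  · have hb := entropy_ne_top v
    lift 𝒮.entropy v to ℝ using ⟨hb, h⟩ with s
    rw [hv, EReal.coe_ennreal_top, ← EReal.coe_mul, EReal.top_sub_coe]

/-- The state of least energy and maximal entropy is the canonical distribution of
temperature zero. -/
theorem IsOptimal.isCanonical_zero {u : 𝒮.P → ℝ≥0∞} {m : ℝ≥0∞} (hu : 𝒮.IsOptimal m u)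
    (hm : ∀ v, 𝒮.IsState v → m ≤ 𝒮.energy v) : 𝒮.IsCanonical 0 u := by
  have hum : 𝒮.freeEnergy 0 u ≤ m := by
    rw [hu.1.freeEnergy_eq, zero_mul, add_zero, EReal.coe_ennreal_toReal hu.1.2]
    exact_mod_cast hu.2.1
  have hmin : 𝒮.IsMinimizer 0 u := by
    refine ⟨hu.1.1, fun v hv => hum.trans (le_trans ?_ (freeEnergy_zero_ge v))⟩
    exact_mod_cast hm v hv
  have hfin : ∀ v, 𝒮.IsMinimizer 0 v → 𝒮.IsFiniteState v ∧ 𝒮.energy v ≤ m := by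
    intro v hv
    have h1 := (freeEnergy_zero_ge v).trans ((hv.2 u hu.1.1).trans hum)
    have h2 : 𝒮.energy v ≤ m := by exact_mod_cast h1
    exact ⟨⟨hv.1, ne_top_of_le_ne_top hu.1.2 (h2.trans (hm u hu.1.1))⟩, h2⟩
  refine Or.inr ⟨rfl, ⟨hmin, fun v hv => ?_⟩, fun v hv => ?_⟩
  · obtain ⟨h1, h2⟩ := hfin v hv
    exact (hu.1.entropy_le_iff h1).2 (hu.2.2 v h1 h2)
  · obtain ⟨h1, h2⟩ := hfin v hv.1
    exact hu.eq_of_le h1 h2 ((h1.entropy_le_iff hu.1).1 (hv.2 u hmin))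

/-- As the entropy is `-relEntropy / mass`, the Lagrange function divided by `β` is the free energy
at temperature `mass / β`. -/
theorem IsFiniteState.isCanonical_of_multiplier {u : 𝒮.P → ℝ≥0∞} (hu : 𝒮.IsFiniteState u) {β : ℝ}
    (hβ : 0 < β) (h : ∀ v, 𝒮.IsFiniteState v →
      𝒮.relEntropy u + β * (𝒮.energy u).toReal ≤ 𝒮.relEntropy v + β * (𝒮.energy v).toReal) :
    𝒮.IsCanonical (𝒮.mass / β) u := by
  have hm := 𝒮.mass_pos
  have hF : ∀ v, 𝒮.IsFiniteState v → 𝒮.freeEnergy (𝒮.mass / β) v =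
      (((𝒮.relEntropy v + β * (𝒮.energy v).toReal) / β : ℝ) : EReal) := by
    intro v hv
    rw [hv.freeEnergy_eq]
    congr 1
    field_simp
    ring
  refine Or.inl ⟨div_pos hm hβ, ⟨hu.1, fun v hv => ?_⟩, fun v hv => ?_⟩
  · by_cases hv' : 𝒮.energy v = ∞
    · rw [freeEnergy_eq_top hv']; exact le_top
    · rw [hF u hu, hF v ⟨hv, hv'⟩, EReal.coe_le_coe_iff, div_le_div_iff_of_pos_right hβ]
      exact h v ⟨hv, hv'⟩
  · have h1 := hv.2 u hu.1
    have hv' : 𝒮.IsFiniteState v := by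
      refine ⟨hv.1, fun hE => ?_⟩
      rw [freeEnergy_eq_top hE, hF u hu] at h1
      exact EReal.coe_ne_top _ (top_le_iff.1 h1)
    rw [hF u hu, hF v hv', EReal.coe_le_coe_iff, div_le_div_iff_of_pos_right hβ] at h1
    refine (hu.eq_of_le_relEntropy_midpoint hv' ?_).symm
    have h2 := h _ (hu.mix hv' (t := 1 / 2) (by norm_num) (by norm_num))
    rw [hu.toReal_energy_mix hv' (by norm_num) (by norm_num)] at h2
    linarith

theorem IsOptimal.isEquilibrium {u : 𝒮.P → ℝ≥0∞} {U : ℝ≥0∞} (hu : 𝒮.IsOptimal U u)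
    (hU : U ≤ 𝒮.energy 𝒮.one) : 𝒮.IsEquilibrium U u := by
  refine ⟨hu.1.1, hu.energy_eq hU, fun v hv hvU => ?_⟩
  have hv' : 𝒮.IsFiniteState v := ⟨hv, by rw [hvU]; exact ne_top_of_le_ne_top isFiniteState_one.2 hU⟩
  exact (hu.1.entropy_le_iff hv').2 (hu.2.2 v hv' hvU.le)

theorem IsOptimal.eq_of_isEquilibrium {u v : 𝒮.P → ℝ≥0∞} {U : ℝ≥0∞} (hu : 𝒮.IsOptimal U u)
    (hU : U ≤ 𝒮.energy 𝒮.one) (hv : 𝒮.IsEquilibrium U v) : v = u := by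
  have hv' : 𝒮.IsFiniteState v :=
    ⟨hv.1, by rw [hv.2.1]; exact ne_top_of_le_ne_top isFiniteState_one.2 hU⟩
  exact hu.eq_of_le hv' hv.2.1.le
    ((hv'.entropy_le_iff hu.1).1 (hv.2.2 u hu.1.1 (hu.energy_eq hU)))

end System
end MuEntropy

theorem mainTheorem8 {E : Type*} [NormedAddCommGroup E] [NormedSpace ℝ E]
    [FiniteDimensional ℝ E] [MeasurableSpace E] [BorelSpace E] (𝒮 : MuEntropy.System E) :
    ∃ m : ℝ≥0∞, IsLeast (𝒮.energy '' {u | 𝒮.IsState u}) m ∧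
      ∀ U ∈ Set.Icc m (𝒮.energy 𝒮.one),
        (∃! u : 𝒮.P → ℝ≥0∞, 𝒮.IsEquilibrium U u) ∧
        ∀ u : 𝒮.P → ℝ≥0∞, 𝒮.IsEquilibrium U u →
          (∃ T : ℝ, 0 ≤ T ∧ 𝒮.IsCanonical T u) ∨
          (m < U ∧ U = 𝒮.energy 𝒮.one ∧ u = 𝒮.one) := by
  open MuEntropy MuEntropy.System in
  -- The infimum is attained by the optimal state for the constraint `c = m`.
  set m := sInf (𝒮.energy '' {u | 𝒮.IsState u}) with hm
  have hmle : ∀ v, 𝒮.IsState v → m ≤ 𝒮.energy v := fun v hv => sInf_le ⟨v, hv, rfl⟩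
  have hopt : ∀ U ∈ Set.Icc m (𝒮.energy 𝒮.one), ∃ u, 𝒮.IsOptimal U u := by
    intro U hU
    refine exists_isOptimal (ne_top_of_le_ne_top isFiniteState_one.2 hU.2) fun b hb => ?_
    obtain ⟨_, ⟨v, hv, rfl⟩, hvb⟩ := sInf_lt_iff.1 (hU.1.trans_lt hb)
    exact ⟨v, hv, hvb.le⟩
  obtain ⟨u₀, hu₀⟩ := hopt m ⟨le_rfl, hmle _ isState_one⟩
  have hu₀m : 𝒮.energy u₀ = m := le_antisymm hu₀.2.1 (hmle u₀ hu₀.1.1)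
  refine ⟨m, ⟨⟨u₀, hu₀.1.1, hu₀m⟩, ?_⟩, fun U hU => ?_⟩
  · rintro _ ⟨v, hv, rfl⟩
    exact hmle v hv
  obtain ⟨u, hu⟩ := hopt U hU
  refine ⟨⟨u, hu.isEquilibrium hU.2, fun v hv => hu.eq_of_isEquilibrium hU.2 hv⟩, fun v hv => ?_⟩
  obtain rfl := hu.eq_of_isEquilibrium hU.2 hv
  rcases hU.1.eq_or_lt with rfl | hmU
  · exact Or.inl ⟨0, le_rfl, hu.isCanonical_zero hmle⟩
  rcases hU.2.eq_or_lt with hU1 | hU1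
  · refine Or.inr ⟨hmU, hU1, hu.1.eq_one_of_relEntropy_le ?_⟩
    have := hu.2.2 _ isFiniteState_one hU1.ge
    rwa [relEntropy_one] at this
  · obtain ⟨β, hβ, h⟩ := hu.exists_multiplier (hu.energy_eq hU.2) hU1 hu₀.1 (by rwa [hu₀m])
    exact Or.inl ⟨_, (div_pos mass_pos hβ).le, hu.1.isCanonical_of_multiplier hβ h⟩
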